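/- Let $n\ge 0$ be an integer, let $\mathcal U(n)=\{U\in\mathbb C^{n\times n}: UU^*=\mathbb 1_n\}$ and consider the skew-Hermitian matrix of one-forms $dG=dU\cdot U^*$ on $\mathcal U(n)$. Let $$\omega=\bigwedge_{j}\operatorname{Im}(dG)_{jj}\wedge\bigwedge_{i<j}\operatorname{Re}(dG)_{ij}\wedge\operatorname{Im}(dG)_{ij}$$ be the wedge product of its $n^2$ independent real entries. Let $[dG]$ denote the Borel measure on $\mathcal U(n)$ defined by $\omega$ with its sign ignored: the least Borel measure that dominates, for every injective $C^1$ immersion $\varphi:V\to\mathcal U(n)$ of an open set $V\subseteq\mathbb R^{n^2}$, the measure $A\mapsto\int_{\varphi^{-1}(A)}|\varphi^*\omega|$. Put $\mathrm{vol}(\mathcal U(n))=\int_{\mathcal U(n)}[dG]$. For $\operatorname{Re}\alpha>n-1$ let $$\widetilde\Gamma_n(\alpha)=\int_{X=X^*>0}|\det X|^{\alpha-n}e^{-\operatorname{Tr}X}\,[dX],\qquad [dX]=\prod_{j\ge k}d(\operatorname{Re}x_{jk})\prod_{j>k}d(\operatorname{Im}x_{jk}),$$ be the complex matrix-variate gamma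 function, the integral being over the positive definite Hermitian $n\times n$ matrices. Then $[dG]$ is the measure given by $|\omega|$ in all local parametrizations, that is, for every $\varphi$ as above and every Borel set $A\subseteq\mathcal U(n)$ one has $\int_{A\cap\varphi(V)}[dG]=\int_{\varphi^{-1}(A)}|\varphi^*\omega|$; the volume of $\mathcal U(n)$ is finite; and $$\mathrm{vol}(\mathcal U(n))=\int_{\mathcal U(n)}[dG]=\frac{2^n\pi^{n^2}}{\widetilde\Gamma_n(n)}=\frac{2^n\pi^{n(n+1)/2}}{1!\,2!\cdots(n-1)!}.$$ -/

import Mathlib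

open MeasureTheory
open scoped ComplexOrder

noncomputable section

/-- The `n²` real coordinates of a skew-Hermitian `n × n` matrix `A`, as a real-linear map:
`Im A_{jj}` on the diagonal and `Im A_{ij}`, `Re A_{ij}` for `i < j`.  The index `(i, j)` with
`i ≤ j` stands for `Im A_{ij}`, the index `(j, i)` with `i < j` stands for `Re A_{ij}`. -/
def skewHermitianCoords (n : ℕ) :
    Matrix (Fin n) (Fin n) ℂ →ₗ[ℝ] (Fin n × Fin n → ℝ) where
  toFun A p := if p.1 ≤ p.2 then (A p.1 p.2).im else (A p.2 p.1).re
  map_add' A B := by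
    funext p
    by_cases h : p.1 ≤ p.2 <;> simp [h]
  map_smul' c A := by
    funext p
    by_cases h : p.1 ≤ p.2 <;> simp [h]

/-- Right multiplication `V ↦ V U*`, as a real-linear map on complex matrices; its value on
`dU` is the skew-Hermitian matrix of differentials `dG = dU · U*`. -/
def mulConjTransposeRight {n : ℕ} (U : Matrix (Fin n) (Fin n) ℂ) :
    Matrix (Fin n) (Fin n) ℂ →ₗ[ℝ] Matrix (Fin n) (Fin n) ℂ :=
  LinearMap.mulRight ℝ U.conjTranspose

/-- The value at `U` of the form `∧ (dU · U*)` of degree `n²`: the wedge product of the `n²` real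
one-forms `Im (dU · U*)_{jj}` and `Re (dU · U*)_{ij}`, `Im (dU · U*)_{ij}` for `i < j`.  As for
every wedge product of one-forms `ℓ_a`, its value on `(v_b)` is `det (ℓ_a (v_b))`. -/
def wedgeForm {n : ℕ} (U : Matrix (Fin n) (Fin n) ℂ) :
    Matrix (Fin n) (Fin n) ℂ [⋀^(Fin n × Fin n)]→ₗ[ℝ] ℝ :=
  Matrix.detRowAlternating.compLinearMap (skewHermitianCoords n ∘ₗ mulConjTransposeRight U)

/-- The Borel σ-algebra of the unitary group, for the topology induced from complex matrices. -/
instance unitaryGroupMeasurableSpace (n : ℕ) :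
    MeasurableSpace (Matrix.unitaryGroup (Fin n) ℂ) :=
  borel _

instance unitaryGroupBorelSpace (n : ℕ) :
    BorelSpace (Matrix.unitaryGroup (Fin n) ℂ) :=
  ⟨rfl⟩

/-- The differential at `x` of a map `φ` from `ℝ^{n²}` to `U(n) ⊆ ℂ^{n×n}` in the direction `v`,
computed entry by entry. -/
def matrixDifferential {n : ℕ} (φ : (Fin n × Fin n → ℝ) → Matrix.unitaryGroup (Fin n) ℂ)
    (x v : Fin n × Fin n → ℝ) : Matrix (Fin n) (Fin n) ℂ :=
  Matrix.of fun i j => fderiv ℝ (fun y => (φ y : Matrix (Fin n) (Fin n) ℂ) i j) x v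

/-- A local parametrization of `U(n)`: an injective `C¹` immersion into `U(n)` of an open
subset of `ℝ^{n²}`.  The values of `toFun` outside `source` play no role. -/
structure UnitaryParametrization (n : ℕ) where
  source : Set (Fin n × Fin n → ℝ)
  toFun : (Fin n × Fin n → ℝ) → Matrix.unitaryGroup (Fin n) ℂ
  isOpen_source : IsOpen source
  contDiffOn : ∀ i j : Fin n,
    ContDiffOn ℝ 1 (fun x => (toFun x : Matrix (Fin n) (Fin n) ℂ) i j) source
  injOn : Set.InjOn toFun source
  immersion : ∀ x ∈ source, Function.Injective (matrixDifferential toFun x)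

namespace UnitaryParametrization

/-- The coefficient at `x` of the pullback of `∧ (dU · U*)` with respect to the coordinates of
`ℝ^{n²}`. -/
def pullbackCoeff {n : ℕ} (φ : UnitaryParametrization n) (x : Fin n × Fin n → ℝ) : ℝ :=
  wedgeForm (φ.toFun x : Matrix (Fin n) (Fin n) ℂ)
    (fun a => matrixDifferential φ.toFun x (Pi.single a 1))

/-- The measure on `U(n)` which `∧ (dU · U*)`, with its sign ignored, defines in the local
parametrization `φ`: it gives a Borel set `A` the mass `∫_{φ⁻¹(A)} |φ^* ∧ (dU · U*)|`. -/
def localMeasure {n : ℕ} (φ : UnitaryParametrization n) :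
    Measure (Matrix.unitaryGroup (Fin n) ℂ) :=
  Measure.map φ.toFun
    ((volume.restrict φ.source).withDensity fun x => ENNReal.ofReal |φ.pullbackCoeff x|)

end UnitaryParametrization

/-- The measure `[dG]` on `U(n)` given by the wedge product `∧ (dU · U*)` with its sign ignored:
the measure glued from the measures that the form defines in local parametrizations, that is, the
least Borel measure which dominates all of them. -/
def unitaryVolumeMeasure (n : ℕ) : Measure (Matrix.unitaryGroup (Fin n) ℂ) :=
  ⨆ φ : UnitaryParametrization n, φ.localMeasure

/-- The volume `∫_{U(n)} [dG]` of the unitary group. -/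
def unitaryVolume (n : ℕ) : ENNReal :=
  ∫⁻ _ : Matrix.unitaryGroup (Fin n) ℂ, 1 ∂(unitaryVolumeMeasure n)

/-- The Hermitian matrix with independent real variables `x`: real parts `x_{jk}`, `j ≥ k`, and
imaginary parts `x_{kj}`, `j > k`, of the entries in the lower triangle. -/
def hermitianOfCoords {n : ℕ} (x : Fin n × Fin n → ℝ) : Matrix (Fin n) (Fin n) ℂ :=
  Matrix.of fun j k =>
    if k < j then (x (j, k) : ℂ) + Complex.I * (x (k, j) : ℂ)
    else if j < k then (x (k, j) : ℂ) - Complex.I * (x (j, k) : ℂ)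
    else (x (j, j) : ℂ)

/-- The complex matrix-variate gamma function (for `Re α > n - 1`): the integral of
`|det X|^(α - n) e^{-Tr X}` over the positive definite Hermitian `n × n` matrices `X`, with respect
to Lebesgue measure in the `n²` independent real variables of `X`. -/
def complexMatrixGamma (n : ℕ) (α : ℂ) : ℂ :=
  ∫ x in {x : Fin n × Fin n → ℝ | (hermitianOfCoords x).PosDef},
    ((‖(hermitianOfCoords x).det‖ : ℝ) : ℂ) ^ (α - n) *
      Complex.exp (-(hermitianOfCoords x).trace)

end

/-!
The measure `[dG]` is identified through the decomposition `Z = T U` of a complex matrix into a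
lower triangular matrix `T` with positive diagonal and a unitary matrix `U`.  By the existence and
uniqueness of the Cholesky decomposition `Z Z* = T T*`, this decomposition exists and is unique for
all invertible `Z`, that is, for almost all `Z` (`lowerMulUnitary_injOn`,
`mem_image_lowerMulUnitary`, `ae_det_ne_zero`).

For a parametrization `φ`, the derivative of `(T, x) ↦ T φ(x)`, multiplied by `U*` on the right, is
`(dT, dG) ↦ dT + T dG`.  Lower triangular matrices with real diagonal have no skew-Hermitian
coordinates, and neither have their products, so this map is block triangular; its determinant is
`J(T) · φ^*(∧ dG)` with `J(T) = ∏_i t_i^{2(n-i)-1}`, `i = 0, …, n-1`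
(`abs_det_lowerMulDerivative`).  Hence, if `Z` is distributed according to `e^{-|Z|²} dZ`, its
unitary factor is distributed on the image of `φ` according to `c · |φ^*(∧ dG)|`, where
`c = ∫ J(T) e^{-|T|²} dT` does not depend on `φ` (`unitaryFactorMeasure_inter_image`).  So all local
measures are restrictions of one finite measure `c⁻¹ ·` (distribution of `U`), and since countably
many rotated Cayley charts cover the group (`exists_countable_cover`), that measure is the supremum
`[dG]` of the local ones (`unitaryVolumeMeasure_eq`).  Its total mass is `π^{n²} / c`.

The constant `c` is a product of one-dimensional integrals (`triangularConstant_eq`).  The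
substitution `X = T T*`, with Jacobian `2^n J(T)` (`det_choleskyDerivative`), turns the
matrix-variate gamma integral at `n` into `2^n c` (`complexMatrixGamma_self`).
-/

open MeasureTheory
open scoped ComplexOrder

/-! ### Real coordinates of complex matrices -/

/-- The `n²` real coordinates of a lower triangular matrix with real diagonal: at `(i, j)` with
`j ≤ i` the real part of the entry `(i, j)`, at `(j, i)` with `j < i` its imaginary part.  They are
complementary to `skewHermitianCoords`: every real coordinate of a complex matrix occurs in exactly
one of the two families. -/
noncomputable def lowerCoords (n : ℕ) :
    Matrix (Fin n) (Fin n) ℂ →ₗ[ℝ] (Fin n × Fin n → ℝ) where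
  toFun A p := if p.2 ≤ p.1 then (A p.1 p.2).re else (A p.2 p.1).im
  map_add' A B := by
    funext p
    by_cases h : p.2 ≤ p.1 <;> simp [h]
  map_smul' c A := by
    funext p
    by_cases h : p.2 ≤ p.1 <;> simp [h]

/-- The lower triangular matrix with real diagonal whose `lowerCoords` are given. -/
noncomputable def lowerMatrix (n : ℕ) :
    (Fin n × Fin n → ℝ) →ₗ[ℝ] Matrix (Fin n) (Fin n) ℂ where
  toFun x := Matrix.of fun i j =>
    if j < i then ⟨x (i, j), x (j, i)⟩ else if i < j then 0 else ⟨x (i, i), 0⟩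
  map_add' x y := by
    ext i j
    rcases lt_trichotomy i j with h | h | h <;> simp [h, h.not_gt, Complex.ext_iff]
  map_smul' c x := by
    ext i j
    rcases lt_trichotomy i j with h | h | h <;> simp [h, h.not_gt, Complex.ext_iff]

/-- The upper triangular matrix with imaginary diagonal whose `skewHermitianCoords` are given. -/
noncomputable def upperMatrix (n : ℕ) :
    (Fin n × Fin n → ℝ) →ₗ[ℝ] Matrix (Fin n) (Fin n) ℂ where
  toFun x := Matrix.of fun i j =>
    if i < j then ⟨x (j, i), x (i, j)⟩ else if j < i then 0 else ⟨0, x (i, i)⟩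
  map_add' x y := by
    ext i j
    rcases lt_trichotomy i j with h | h | h <;> simp [h, h.not_gt, Complex.ext_iff]
  map_smul' c x := by
    ext i j
    rcases lt_trichotomy i j with h | h | h <;> simp [h, h.not_gt, Complex.ext_iff]

section Coordinates

variable {n : ℕ}

lemma lowerMatrix_apply_of_lt (x : Fin n × Fin n → ℝ) {i j : Fin n} (h : j < i) :
    lowerMatrix n x i j = ⟨x (i, j), x (j, i)⟩ := by
  simp [lowerMatrix, h]

lemma lowerMatrix_apply_self (x : Fin n × Fin n → ℝ) (i : Fin n) :
    lowerMatrix n x i i = (x (i, i) : ℂ) := by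
  simp [lowerMatrix, Complex.ext_iff]

lemma lowerMatrix_apply_of_gt (x : Fin n × Fin n → ℝ) {i j : Fin n} (h : i < j) :
    lowerMatrix n x i j = 0 := by
  simp [lowerMatrix, h, h.not_gt]

lemma upperMatrix_apply_of_lt (x : Fin n × Fin n → ℝ) {i j : Fin n} (h : i < j) :
    upperMatrix n x i j = ⟨x (j, i), x (i, j)⟩ := by
  simp [upperMatrix, h]

lemma upperMatrix_apply_self (x : Fin n × Fin n → ℝ) (i : Fin n) :
    upperMatrix n x i i = ⟨0, x (i, i)⟩ := by
  simp [upperMatrix]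

lemma lowerCoords_lowerMatrix (x : Fin n × Fin n → ℝ) :
    lowerCoords n (lowerMatrix n x) = x := by
  funext ⟨i, j⟩
  rcases lt_trichotomy i j with h | h | h
  · simp [lowerCoords, lowerMatrix, h, h.not_ge]
  · subst h; simp [lowerCoords, lowerMatrix]
  · simp [lowerCoords, lowerMatrix, h, h.le]

lemma skewHermitianCoords_upperMatrix (x : Fin n × Fin n → ℝ) :
    skewHermitianCoords n (upperMatrix n x) = x := by
  funext ⟨i, j⟩
  rcases lt_trichotomy i j with h | h | h
  · simp [skewHermitianCoords, upperMatrix, h, h.le]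
  · subst h; simp [skewHermitianCoords, upperMatrix]
  · simp [skewHermitianCoords, upperMatrix, h, h.not_ge]

lemma lowerCoords_upperMatrix (x : Fin n × Fin n → ℝ) :
    lowerCoords n (upperMatrix n x) = 0 := by
  funext ⟨i, j⟩
  rcases lt_trichotomy i j with h | h | h
  · simp [lowerCoords, upperMatrix, h, h.not_ge, h.not_gt]
  · subst h; simp [lowerCoords, upperMatrix]
  · simp [lowerCoords, upperMatrix, h, h.le, h.not_gt]

lemma skewHermitianCoords_lowerMatrix (x : Fin n × Fin n → ℝ) :
    skewHermitianCoords n (lowerMatrix n x) = 0 := by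
  funext ⟨i, j⟩
  rcases lt_trichotomy i j with h | h | h
  · simp [skewHermitianCoords, lowerMatrix, h, h.le, h.not_gt]
  · subst h; simp [skewHermitianCoords, lowerMatrix]
  · simp [skewHermitianCoords, lowerMatrix, h, h.not_ge, h.not_gt]

lemma lowerMatrix_add_upperMatrix (A : Matrix (Fin n) (Fin n) ℂ) :
    lowerMatrix n (lowerCoords n A) + upperMatrix n (skewHermitianCoords n A) = A := by
  ext i j
  rcases lt_trichotomy i j with h | h | h
  · simp [lowerCoords, skewHermitianCoords, lowerMatrix, upperMatrix, h, h.le, h.not_ge, h.not_gt]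
  · subst h; simp [lowerCoords, skewHermitianCoords, lowerMatrix, upperMatrix, Complex.ext_iff]
  · simp [lowerCoords, skewHermitianCoords, lowerMatrix, upperMatrix, h, h.le, h.not_ge, h.not_gt]

/-- Complex matrices as `ℝ^{n²} × ℝ^{n²}`: lower triangular and skew-Hermitian coordinates. -/
noncomputable def matrixCoords (n : ℕ) :
    Matrix (Fin n) (Fin n) ℂ ≃ₗ[ℝ] (Fin n × Fin n → ℝ) × (Fin n × Fin n → ℝ) where
  __ := (lowerCoords n).prod (skewHermitianCoords n)
  invFun e := lowerMatrix n e.1 + upperMatrix n e.2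
  left_inv A := lowerMatrix_add_upperMatrix A
  right_inv e := by
    ext1 <;> simp [lowerCoords_lowerMatrix, lowerCoords_upperMatrix,
      skewHermitianCoords_lowerMatrix, skewHermitianCoords_upperMatrix]

lemma matrixCoords_apply (A : Matrix (Fin n) (Fin n) ℂ) :
    matrixCoords n A = (lowerCoords n A, skewHermitianCoords n A) := rfl

/-- The coordinates `matrixCoords` are orthonormal for the real inner product `Re Tr (A B*)`. -/
lemma sum_coords_mul_coords (A B : Matrix (Fin n) (Fin n) ℂ) :
    ∑ p, lowerCoords n A p * lowerCoords n B p +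
      ∑ p, skewHermitianCoords n A p * skewHermitianCoords n B p =
    (A * B.conjTranspose).trace.re := by
  have hl : ∑ p, lowerCoords n A p * lowerCoords n B p =
      ∑ p, lowerCoords n A (Prod.swap p) * lowerCoords n B (Prod.swap p) :=
    ((Equiv.prodComm (Fin n) (Fin n)).sum_comp
      fun p => lowerCoords n A p * lowerCoords n B p).symm
  have h1 : ∀ p : Fin n × Fin n, lowerCoords n A p.swap * lowerCoords n B p.swap +
      skewHermitianCoords n A p * skewHermitianCoords n B p =
      (A p.2 p.1).re * (B p.2 p.1).re + (A p.1 p.2).im * (B p.1 p.2).im := by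
    intro p
    by_cases h : p.1 ≤ p.2 <;> simp [lowerCoords, skewHermitianCoords, h]
    ring
  have h2 : ∑ p : Fin n × Fin n, (A p.2 p.1).re * (B p.2 p.1).re =
      ∑ p : Fin n × Fin n, (A p.1 p.2).re * (B p.1 p.2).re :=
    (Equiv.prodComm (Fin n) (Fin n)).sum_comp fun p => (A p.1 p.2).re * (B p.1 p.2).re
  rw [hl, ← Finset.sum_add_distrib, Finset.sum_congr rfl fun p _ => h1 p,
    Finset.sum_add_distrib, h2, ← Finset.sum_add_distrib, Fintype.sum_prod_type]
  simp [Matrix.trace, Matrix.mul_apply]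

/-! ### Determinants of triangular linear maps -/

/-- A linear endomorphism of `ℝ^ι` that multiplies the coordinate `p` by `d p`, up to terms in
coordinates of lower rank, has determinant `∏ d p`. -/
lemma LinearMap.det_eq_prod_of_triangular {ι : Type*} [Fintype ι] [DecidableEq ι]
    (f : (ι → ℝ) →ₗ[ℝ] (ι → ℝ)) (r : ι → ℕ) (d : ι → ℝ)
    (h : ∀ x p, (∀ q, r q < r p → x q = 0) → f x p = d p * x p) :
    LinearMap.det f = ∏ p, d p := by
  -- coordinates of equal rank do not interact: the diagonal blocks are diagonal matrices
  have hM : ∀ p q, ¬ r q < r p → LinearMap.toMatrix' f p q = if p = q then d p else 0 := by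
    intro p q hpq
    rw [LinearMap.toMatrix'_apply, h]
    · by_cases e : p = q <;> simp [e]
    · intro q' hq'
      have : q' ≠ q := by rintro rfl; exact hpq hq'
      simp [this]
  rw [← LinearMap.det_toMatrix']
  have hT : (LinearMap.toMatrix' f).BlockTriangular (OrderDual.toDual ∘ r) := by
    intro p q hpq
    have hlt : r p < r q := hpq
    rw [hM p q hlt.not_gt, if_neg]
    rintro rfl
    exact lt_irrefl _ hlt
  rw [hT.det, ← Finset.prod_fiberwise_of_maps_to
    (t := Finset.univ.image (OrderDual.toDual ∘ r)) (g := OrderDual.toDual ∘ r)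
    (fun p hp => Finset.mem_image_of_mem _ hp)]
  refine Finset.prod_congr rfl fun a _ => ?_
  have hD : (LinearMap.toMatrix' f).toSquareBlock (OrderDual.toDual ∘ r) a =
      Matrix.diagonal fun p => d p.1 := by
    ext p q
    have e : r q = r p := q.2.trans p.2.symm
    rw [Matrix.toSquareBlock_def, Matrix.of_apply, hM _ _ (by omega), Matrix.diagonal_apply]
    simp [Subtype.ext_iff]
  rw [hD, Matrix.det_diagonal]
  exact (Finset.prod_subtype _ (by simp) _).symm

/-- `∏_i t_i^{2(n-i)-1}` (`i = 0, …, n-1`): the Jacobian of `(T, U) ↦ T U` on lower triangular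
matrices with diagonal `t_i = x (i, i)` and unitary matrices.  The product over the pairs `(i, j)`
of `t_{min(i, j)}` is the form in which it arises as a determinant. -/
noncomputable def triangularJacobian (x : Fin n × Fin n → ℝ) : ℝ :=
  ∏ p : Fin n × Fin n, x (min p.1 p.2, min p.1 p.2)

/-- `upperMatrix x ↦ T * upperMatrix x`, in skew-Hermitian coordinates. -/
noncomputable def mulLowerSkew (t : Fin n × Fin n → ℝ) :
    (Fin n × Fin n → ℝ) →ₗ[ℝ] (Fin n × Fin n → ℝ) :=
  skewHermitianCoords n ∘ₗ LinearMap.mulLeft ℝ (lowerMatrix n t) ∘ₗ upperMatrix n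

lemma lowerMatrix_mul_apply (t : Fin n × Fin n → ℝ) (B : Matrix (Fin n) (Fin n) ℂ) (i j : Fin n)
    (h : ∀ k < i, B k j = 0) : (lowerMatrix n t * B) i j = (t (i, i) : ℂ) * B i j := by
  rw [Matrix.mul_apply, Finset.sum_eq_single i, lowerMatrix_apply_self]
  · intro k _ hk
    rcases hk.lt_or_gt with hk | hk
    · rw [h k hk, mul_zero]
    · rw [lowerMatrix_apply_of_gt t hk, zero_mul]
  · simp

lemma det_mulLowerSkew (t : Fin n × Fin n → ℝ) :
    LinearMap.det (mulLowerSkew t) = triangularJacobian t := by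
  refine LinearMap.det_eq_prod_of_triangular _ (fun p => (min p.1 p.2 : Fin n).val) _ ?_
  rintro x ⟨i, j⟩ hx
  -- on and above the diagonal, row `a` of `T B` involves only the rows `k ≤ a` of `B`
  have hB : ∀ a b, a ≤ b → min a b = min i j →
      (lowerMatrix n t * upperMatrix n x) a b = (t (a, a) : ℂ) * upperMatrix n x a b := by
    intro a b hab hm
    refine lowerMatrix_mul_apply t _ a b fun k hk => ?_
    have hkb : k < b := hk.trans_le hab
    rw [min_eq_left hab] at hm
    rw [upperMatrix_apply_of_lt x hkb, hx (b, k), hx (k, b)]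
    · rfl
    · show (min k b).val < (min i j).val
      rw [min_eq_left hkb.le, ← hm]; exact hk
    · show (min b k).val < (min i j).val
      rw [min_eq_right hkb.le, ← hm]; exact hk
  change skewHermitianCoords n (lowerMatrix n t * upperMatrix n x) (i, j) = _
  rcases lt_trichotomy i j with h | h | h
  · simp [skewHermitianCoords, h.le, hB i j h.le rfl, upperMatrix_apply_of_lt x h]
  · subst h
    simp [skewHermitianCoords, hB i i le_rfl rfl, upperMatrix_apply_self x]
  · simp [skewHermitianCoords, h.not_ge, hB j i h.le (min_comm _ _), upperMatrix_apply_of_lt x h,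
      min_eq_right h.le]

lemma lowerMatrix_mul_lowerMatrix (s t : Fin n × Fin n → ℝ) :
    skewHermitianCoords n (lowerMatrix n s * lowerMatrix n t) = 0 := by
  have h0 : ∀ i j, i < j → (lowerMatrix n s * lowerMatrix n t) i j = 0 := fun i j h => by
    rw [lowerMatrix_mul_apply s _ i j fun k hk => lowerMatrix_apply_of_gt t (hk.trans h),
      lowerMatrix_apply_of_gt t h, mul_zero]
  funext ⟨i, j⟩
  rcases lt_trichotomy i j with h | h | h
  · simp [skewHermitianCoords, h.le, h0 i j h]
  · subst h
    simp [skewHermitianCoords, lowerMatrix_mul_apply s _ i i fun k hk =>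
      lowerMatrix_apply_of_gt t hk, lowerMatrix_apply_self]
  · simp [skewHermitianCoords, h.not_ge, h0 j i h]

/-- The skew-Hermitian coordinates of `T B` depend only on those of `B`, since products of lower
triangular matrices with real diagonal have none. -/
lemma skewHermitianCoords_lowerMatrix_mul (t : Fin n × Fin n → ℝ)
    (B : Matrix (Fin n) (Fin n) ℂ) :
    skewHermitianCoords n (lowerMatrix n t * B) = mulLowerSkew t (skewHermitianCoords n B) := by
  conv_lhs => rw [← lowerMatrix_add_upperMatrix B, mul_add, map_add, lowerMatrix_mul_lowerMatrix,
    zero_add]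
  rfl

/-- Right multiplication by `U` as an endomorphism of `ℝ^{n²} × ℝ^{n²}`. -/
noncomputable def mulRightCoords (U : Matrix (Fin n) (Fin n) ℂ) :
    (Fin n × Fin n → ℝ) × (Fin n × Fin n → ℝ) →ₗ[ℝ] (Fin n × Fin n → ℝ) × (Fin n × Fin n → ℝ) :=
  (matrixCoords n).toLinearMap ∘ₗ LinearMap.mulRight ℝ U ∘ₗ (matrixCoords n).symm.toLinearMap

end Coordinates

section Orthogonal

variable {n : ℕ}

/-- In the orthonormal coordinates `matrixCoords` the matrix of right multiplication by `U*` is the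
transpose of that of right multiplication by `U`; for unitary `U` it is also the inverse. -/
lemma abs_det_mulRightCoords (U : Matrix.unitaryGroup (Fin n) ℂ) :
    |LinearMap.det (mulRightCoords (U : Matrix (Fin n) (Fin n) ℂ))| = 1 := by
  let ι := Fin n × Fin n
  let dot : (ι → ℝ) × (ι → ℝ) → (ι → ℝ) × (ι → ℝ) → ℝ := fun a b =>
    ∑ p, a.1 p * b.1 p + ∑ p, a.2 p * b.2 p
  have hdot : ∀ a b, dot a b =
      ((matrixCoords n).symm a * ((matrixCoords n).symm b).conjTranspose).trace.re := by
    intro a b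
    have h := sum_coords_mul_coords ((matrixCoords n).symm a) ((matrixCoords n).symm b)
    have ha : ∀ c, (lowerCoords n ((matrixCoords n).symm c),
        skewHermitianCoords n ((matrixCoords n).symm c)) = c := fun c =>
      (matrixCoords n).apply_symm_apply c
    have h1 : ∀ c, lowerCoords n ((matrixCoords n).symm c) = c.1 :=
      fun c => congrArg Prod.fst (ha c)
    have h2 : ∀ c, skewHermitianCoords n ((matrixCoords n).symm c) = c.2 :=
      fun c => congrArg Prod.snd (ha c)
    rw [← h, h1, h1, h2, h2]
  have hadj : ∀ (V : Matrix (Fin n) (Fin n) ℂ) a b, dot (mulRightCoords V a) b =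
      dot a (mulRightCoords V.conjTranspose b) := by
    intro V a b
    simp [hdot, mulRightCoords, Matrix.mul_assoc]
  let bas := (Pi.basisFun ℝ ι).prod (Pi.basisFun ℝ ι)
  have hrepr : ∀ e l, bas.repr e l = dot e (bas l) := by
    rintro e (l | l) <;> simp [bas, dot, Pi.single_apply]
  have hsymm : ∀ a b, dot a b = dot b a := fun a b => by simp [dot, mul_comm]
  have htr : LinearMap.toMatrix bas bas
        (mulRightCoords (U : Matrix (Fin n) (Fin n) ℂ).conjTranspose)
      = (LinearMap.toMatrix bas bas (mulRightCoords (U : Matrix (Fin n) (Fin n) ℂ))).transpose := by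
    ext k l
    rw [Matrix.transpose_apply, LinearMap.toMatrix_apply, LinearMap.toMatrix_apply, hrepr, hrepr,
      hadj, hsymm, Matrix.conjTranspose_conjTranspose]
  have hcomp : mulRightCoords (U : Matrix (Fin n) (Fin n) ℂ).conjTranspose ∘ₗ
      mulRightCoords (U : Matrix (Fin n) (Fin n) ℂ) = LinearMap.id := by
    have hU : (U : Matrix (Fin n) (Fin n) ℂ) * (U : Matrix (Fin n) (Fin n) ℂ).conjTranspose = 1 :=
      Matrix.mem_unitaryGroup_iff.1 U.2
    refine LinearMap.ext fun e => ?_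
    simp only [mulRightCoords, LinearMap.comp_apply, LinearEquiv.coe_coe,
      LinearEquiv.symm_apply_apply, LinearMap.mulRight_apply, LinearMap.id_apply]
    rw [mul_assoc, hU, mul_one, LinearEquiv.apply_symm_apply]
  have hdet := congrArg LinearMap.det hcomp
  rw [LinearMap.det_comp, LinearMap.det_id, ← LinearMap.det_toMatrix bas, htr,
    Matrix.det_transpose, LinearMap.det_toMatrix] at hdet
  rcases mul_self_eq_one_iff.1 hdet with h | h <;> simp [h]

end Orthogonal

/-! ### The Cholesky decomposition -/

section Cholesky

variable {n : ℕ}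

/-- Coordinates of the lower triangular matrices with positive diagonal. -/
def positiveDiagonal (n : ℕ) : Set (Fin n × Fin n → ℝ) := {t | ∀ i, 0 < t (i, i)}

lemma isOpen_positiveDiagonal (n : ℕ) : IsOpen (positiveDiagonal n) := by
  simp only [positiveDiagonal, Set.ofPred_forall]
  exact isOpen_iInter_of_finite fun i => isOpen_lt continuous_const (continuous_apply _)

lemma triangularJacobian_pos {t : Fin n × Fin n → ℝ} (ht : t ∈ positiveDiagonal n) :
    0 < triangularJacobian t :=
  Finset.prod_pos fun _ _ => ht _

lemma isUnit_det_lowerMatrix {t : Fin n × Fin n → ℝ} (ht : t ∈ positiveDiagonal n) :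
    IsUnit (lowerMatrix n t).det := by
  rw [Matrix.det_of_isLowerTriangular _ fun i j hij => lowerMatrix_apply_of_gt t hij]
  refine isUnit_iff_ne_zero.2 (Finset.prod_ne_zero_iff.2 fun i _ => ?_)
  rw [lowerMatrix_apply_self]
  exact_mod_cast (ht i).ne'

/-- The lower triangular factor of a Cholesky decomposition is determined column by column. -/
lemma lowerMatrix_mul_conjTranspose_injOn :
    Set.InjOn (fun t => lowerMatrix n t * (lowerMatrix n t).conjTranspose)
      (positiveDiagonal n) := by
  intro s hs t ht hst
  have key : ∀ m : ℕ, ∀ j : Fin n, j.val = m → ∀ i, lowerMatrix n s i j = lowerMatrix n t i j := by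
    intro m
    induction m using Nat.strong_induction_on with
    | _ m ih =>
      intro j hj
      have hsum : ∀ (u : Fin n × Fin n → ℝ) i,
          (lowerMatrix n u * (lowerMatrix n u).conjTranspose) i j =
          lowerMatrix n u i j * (u (j, j) : ℂ) +
            ∑ k with k < j, lowerMatrix n u i k * star (lowerMatrix n u j k) := by
        intro u i
        rw [Matrix.mul_apply, ← Finset.add_sum_erase _ _ (Finset.mem_univ j)]
        congr 1
        · rw [Matrix.conjTranspose_apply, lowerMatrix_apply_self]; simp
        · symm
          refine Finset.sum_subset (fun k hk => ?_) fun k hk hk' => ?_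
          · simp only [Finset.mem_filter, Finset.mem_univ, true_and] at hk
            simp [hk.ne]
          · have h1 : j < k := lt_of_le_of_ne (by simpa using hk') (Finset.ne_of_mem_erase hk).symm
            change _ * star (lowerMatrix n u j k) = 0
            rw [lowerMatrix_apply_of_gt u h1, star_zero, mul_zero]
      have hprod : ∀ i, lowerMatrix n s i j * (s (j, j) : ℂ) =
          lowerMatrix n t i j * (t (j, j) : ℂ) := by
        intro i
        have h := congrFun (congrFun hst i) j
        simp only [hsum] at h
        rw [Finset.sum_congr rfl fun k hk => ?_] at h
        · exact add_right_cancel h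
        · have hk' : k < j := by simpa using hk
          rw [ih k.val (hj ▸ hk') k rfl i, ih k.val (hj ▸ hk') k rfl j]
      have hjj : s (j, j) = t (j, j) := by
        have h := hprod j
        rw [lowerMatrix_apply_self, lowerMatrix_apply_self] at h
        have h' : s (j, j) * s (j, j) = t (j, j) * t (j, j) := by exact_mod_cast h
        exact (mul_self_inj (hs j).le (ht j).le).1 h'
      intro i
      have h := hprod i
      rw [hjj] at h
      exact mul_right_cancel₀ (by exact_mod_cast (ht j).ne') h
  have hM : lowerMatrix n s = lowerMatrix n t := by
    ext i j; exact key j.val j rfl i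
  rw [← lowerCoords_lowerMatrix s, hM, lowerCoords_lowerMatrix]

/-- Existence of the Cholesky decomposition: the `LDL` decomposition with the diagonal factor and
the phases of the diagonal of `L` absorbed. -/
lemma exists_lowerMatrix_mul_conjTranspose {S : Matrix (Fin n) (Fin n) ℂ} (hS : S.PosDef) :
    ∃ t ∈ positiveDiagonal n, lowerMatrix n t * (lowerMatrix n t).conjTranspose = S := by
  set K := LDL.lowerInv hS with hK
  have hKlow : K.IsLowerTriangular := fun i j hij => LDL.lowerInv_triangular hS hij
  have hKunit : IsUnit K.det := by
    have := Matrix.isUnit_det_of_invertible K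
    exact this
  have hKd : ∀ i, K i i ≠ 0 := by
    have h := hKunit.ne_zero
    rw [Matrix.det_of_isLowerTriangular _ hKlow] at h
    exact fun i => Finset.prod_ne_zero_iff.1 h i (Finset.mem_univ i)
  have hD : (LDL.diag hS).PosDef := by
    rw [LDL.diag_eq_lowerInv_conj]
    refine (Matrix.IsUnit.posDef_star_right_conjugate_iff ?_).2 hS
    exact (Matrix.isUnit_iff_isUnit_det _).2 hKunit
  have hd : ∀ i, 0 < LDL.diagEntries hS i := by
    intro i
    have := hD.diag_pos (i := i)
    simpa [LDL.diag] using this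
  choose r hr hrd using fun i => (RCLike.pos_iff_exists_ofReal (K := ℂ)).1 (hd i)
  -- `T = K⁻¹ diag(c)`, where `K` is the inverse of `L`: the moduli of `c` absorb the diagonal
  -- factor, the phases make the diagonal of the triangular factor positive
  let c : Fin n → ℂ := fun i => (K i i / ‖K i i‖) * (√(r i) : ℝ)
  have hc : ∀ i, c i * star (c i) = r i := by
    intro i
    have h1 : (‖K i i‖ : ℂ) ≠ 0 := by exact_mod_cast norm_ne_zero_iff.2 (hKd i)
    have h2 : K i i * star (K i i) = (‖K i i‖ : ℂ) ^ 2 := Complex.mul_conj' _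
    have h3 : ((√(r i) : ℝ) : ℂ) * (√(r i) : ℝ) = r i := by
      exact_mod_cast Real.mul_self_sqrt (hr i).le
    have h4 : star (c i) = (star (K i i) / ‖K i i‖) * (√(r i) : ℝ) := by
      simp [c]
    rw [h4]
    calc (K i i / ‖K i i‖) * (√(r i) : ℝ) * ((star (K i i) / ‖K i i‖) * (√(r i) : ℝ))
        = (K i i * star (K i i)) / (‖K i i‖ : ℂ) ^ 2 * ((√(r i) : ℝ) * (√(r i) : ℝ)) := by
          field_simp
      _ = r i := by rw [h2, h3, div_self (pow_ne_zero 2 h1), one_mul]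
  have hinv : K⁻¹.IsLowerTriangular := by
    have : Invertible K := LDL.invertibleLowerInv hS
    exact Matrix.blockTriangular_inv_of_blockTriangular hKlow
  have hinvd : ∀ i, K⁻¹ i i = (K i i)⁻¹ := by
    intro i
    have h := congrFun (congrFun (Matrix.nonsing_inv_mul K hKunit) i) i
    rw [Matrix.mul_apply, Finset.sum_eq_single i, Matrix.one_apply_eq] at h
    · exact eq_inv_of_mul_eq_one_left h
    · intro k _ hk
      rcases hk.lt_or_gt with hk | hk
      · rw [hKlow hk, mul_zero]
      · rw [hinv hk, zero_mul]
    · simp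
  set T := K⁻¹ * Matrix.diagonal c with hT
  have hTd : ∀ i, T i i = ((√(r i) / ‖K i i‖ : ℝ) : ℂ) := by
    intro i
    rw [hT, Matrix.mul_diagonal, hinvd]
    simp only [c]
    have := hKd i
    push_cast
    field_simp
  have hTT : T * T.conjTranspose = S := by
    have hdiag : Matrix.diagonal c * (Matrix.diagonal c).conjTranspose = LDL.diag hS := by
      rw [Matrix.diagonal_conjTranspose, Matrix.diagonal_mul_diagonal, LDL.diag]
      congr 1
      funext i
      exact (hc i).trans (hrd i)
    have := LDL.lower_conj_diag hS
    rw [LDL.lower, ← hdiag, ← hK] at this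
    rw [← this, hT, Matrix.conjTranspose_mul]
    simp only [Matrix.mul_assoc]
  have hTl : lowerMatrix n (lowerCoords n T) = T := by
    have hsk : skewHermitianCoords n T = 0 := by
      have h0 : ∀ i j, i < j → T i j = 0 := fun i j hij => by
        rw [hT, Matrix.mul_diagonal, hinv hij, zero_mul]
      funext ⟨i, j⟩
      rcases lt_trichotomy i j with h | h | h
      · simp [skewHermitianCoords, h.le, h0 i j h]
      · subst h; simp [skewHermitianCoords, hTd, -Complex.ofReal_div]
      · simp [skewHermitianCoords, h.not_ge, h0 j i h]
    have := lowerMatrix_add_upperMatrix T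
    rwa [hsk, map_zero, add_zero] at this
  refine ⟨lowerCoords n T, fun i => ?_, by rw [hTl, hTT]⟩
  have : lowerCoords n T (i, i) = √(r i) / ‖K i i‖ := by
    simp [lowerCoords, hTd, -Complex.ofReal_div]
  rw [this]
  exact div_pos (Real.sqrt_pos.2 (hr i)) (norm_pos_iff.2 (hKd i))

/-- The map `(T, U) ↦ T U`, in real coordinates. -/
noncomputable def lowerMulUnitary (n : ℕ)
    (a : (Fin n × Fin n → ℝ) × Matrix.unitaryGroup (Fin n) ℂ) :
    (Fin n × Fin n → ℝ) × (Fin n × Fin n → ℝ) :=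
  matrixCoords n (lowerMatrix n a.1 * (a.2 : Matrix (Fin n) (Fin n) ℂ))

lemma lowerMulUnitary_injOn :
    Set.InjOn (lowerMulUnitary n) (positiveDiagonal n ×ˢ Set.univ) := by
  rintro ⟨s, U⟩ ⟨hs, -⟩ ⟨t, V⟩ ⟨ht, -⟩ h
  have h1 : lowerMatrix n s * (U : Matrix (Fin n) (Fin n) ℂ) =
      lowerMatrix n t * (V : Matrix (Fin n) (Fin n) ℂ) := (matrixCoords n).injective h
  have hc : ∀ (u : Fin n × Fin n → ℝ) (W : Matrix.unitaryGroup (Fin n) ℂ),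
      lowerMatrix n u * (lowerMatrix n u).conjTranspose =
      (lowerMatrix n u * (W : Matrix (Fin n) (Fin n) ℂ)) *
        (lowerMatrix n u * (W : Matrix (Fin n) (Fin n) ℂ)).conjTranspose := by
    intro u W
    have hW : (W : Matrix (Fin n) (Fin n) ℂ) * (W : Matrix (Fin n) (Fin n) ℂ).conjTranspose = 1 :=
      Matrix.mem_unitaryGroup_iff.1 W.2
    rw [Matrix.conjTranspose_mul, mul_assoc, ← mul_assoc (W : Matrix (Fin n) (Fin n) ℂ), hW,
      one_mul]
  have hst : s = t := lowerMatrix_mul_conjTranspose_injOn hs ht (by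
    change lowerMatrix n s * _ = lowerMatrix n t * _
    rw [hc s U, hc t V, h1])
  subst hst
  have hUV : (U : Matrix (Fin n) (Fin n) ℂ) = V :=
    (Matrix.isUnit_iff_isUnit_det _).2 (isUnit_det_lowerMatrix hs) |>.mul_left_cancel h1
  exact Prod.ext rfl (Subtype.ext hUV)

/-- Existence of the decomposition `Z = T U`. -/
lemma mem_image_lowerMulUnitary {e : (Fin n × Fin n → ℝ) × (Fin n × Fin n → ℝ)}
    (he : ((matrixCoords n).symm e).det ≠ 0) :
    e ∈ lowerMulUnitary n '' (positiveDiagonal n ×ˢ Set.univ) := by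
  set Z := (matrixCoords n).symm e with hZ
  have hZu : IsUnit Z := (Matrix.isUnit_iff_isUnit_det _).2 he.isUnit
  have hpos : (Z * Z.conjTranspose).PosDef := by
    have := (Matrix.IsUnit.posDef_star_right_conjugate_iff hZu).2
      (Matrix.PosDef.one (n := Fin n) (R := ℂ))
    simpa [Matrix.star_eq_conjTranspose] using this
  obtain ⟨t, ht, htZ⟩ := exists_lowerMatrix_mul_conjTranspose hpos
  have hu := isUnit_det_lowerMatrix ht
  have huc : IsUnit (lowerMatrix n t).conjTranspose.det := by
    rw [Matrix.det_conjTranspose]; exact hu.star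
  have hU : (lowerMatrix n t)⁻¹ * Z ∈ Matrix.unitaryGroup (Fin n) ℂ := by
    rw [Matrix.mem_unitaryGroup_iff, Matrix.star_eq_conjTranspose, Matrix.conjTranspose_mul,
      mul_assoc, ← mul_assoc Z, ← htZ, Matrix.conjTranspose_nonsing_inv, mul_assoc,
      Matrix.mul_nonsing_inv _ huc, mul_one, Matrix.nonsing_inv_mul _ hu]
  refine ⟨(t, ⟨_, hU⟩), ⟨ht, trivial⟩, ?_⟩
  simp only [lowerMulUnitary]
  rw [← mul_assoc, Matrix.mul_nonsing_inv _ hu, one_mul, hZ, LinearEquiv.apply_symm_apply]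

end Cholesky

/-! ### Derivatives of matrix-valued maps -/

section Derivative

open scoped Matrix.Norms.Operator

variable {n : ℕ} {E : Type*} [NormedAddCommGroup E] [NormedSpace ℝ E]

/-- The derivative of a matrix-valued map, entry by entry. -/
noncomputable def entrywiseFDeriv (M : E → Matrix (Fin n) (Fin n) ℂ) (x : E) :
    E →L[ℝ] Matrix (Fin n) (Fin n) ℂ :=
  ∑ i, ∑ j, (LinearMap.toContinuousLinearMap (Matrix.singleLinearMap ℝ i j)) ∘L
    (fderiv ℝ (fun y => M y i j) x)

lemma entrywiseFDeriv_apply (M : E → Matrix (Fin n) (Fin n) ℂ) (x v : E) :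
    entrywiseFDeriv M x v = Matrix.of fun i j => fderiv ℝ (fun y => M y i j) x v := by
  rw [Matrix.matrix_eq_sum_single (Matrix.of fun i j => fderiv ℝ (fun y => M y i j) x v)]
  simp [entrywiseFDeriv]

lemma hasFDerivAt_entrywiseFDeriv {M : E → Matrix (Fin n) (Fin n) ℂ} {x : E}
    (h : ∀ i j, DifferentiableAt ℝ (fun y => M y i j) x) :
    HasFDerivAt M (entrywiseFDeriv M x) x := by
  have hM : M = fun y => ∑ i, ∑ j,
      (LinearMap.toContinuousLinearMap (Matrix.singleLinearMap ℝ i j)) (M y i j) := by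
    funext y
    simpa using Matrix.matrix_eq_sum_single (M y)
  have : HasFDerivAt (fun y => ∑ i, ∑ j,
      (LinearMap.toContinuousLinearMap (Matrix.singleLinearMap ℝ i j)) (M y i j))
      (entrywiseFDeriv M x) x := by
    refine HasFDerivAt.fun_sum fun i _ => HasFDerivAt.fun_sum fun j _ => ?_
    exact (ContinuousLinearMap.hasFDerivAt _).comp x (h i j).hasFDerivAt
  rw [← hM] at this
  exact this

/-- The derivative of `(T, x) ↦ T φ(x)` at `(t, x)`, in real coordinates: `T (T⁻¹ dT + dG) U`. -/
noncomputable def lowerMulDerivative (φ : UnitaryParametrization n) (t x : Fin n × Fin n → ℝ) :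
    (Fin n × Fin n → ℝ) × (Fin n × Fin n → ℝ) →ₗ[ℝ] (Fin n × Fin n → ℝ) × (Fin n × Fin n → ℝ) :=
  (matrixCoords n).toLinearMap ∘ₗ
    (LinearMap.mulRight ℝ (φ.toFun x : Matrix (Fin n) (Fin n) ℂ) ∘ₗ lowerMatrix n ∘ₗ
        LinearMap.fst ℝ _ _ +
      LinearMap.mulLeft ℝ (lowerMatrix n t) ∘ₗ
        (entrywiseFDeriv (fun y => (φ.toFun y : Matrix (Fin n) (Fin n) ℂ)) x).toLinearMap ∘ₗ
        LinearMap.snd ℝ _ _)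

lemma UnitaryParametrization.differentiableAt (φ : UnitaryParametrization n)
    {x : Fin n × Fin n → ℝ} (hx : x ∈ φ.source) (i j : Fin n) :
    DifferentiableAt ℝ (fun y => (φ.toFun y : Matrix (Fin n) (Fin n) ℂ) i j) x :=
  ((φ.contDiffOn i j).differentiableOn one_ne_zero).differentiableAt
    (φ.isOpen_source.mem_nhds hx)

lemma hasFDerivAt_lowerMulUnitary (φ : UnitaryParametrization n) (t : Fin n × Fin n → ℝ)
    {x : Fin n × Fin n → ℝ} (hx : x ∈ φ.source) :
    HasFDerivAt (fun a : (Fin n × Fin n → ℝ) × (Fin n × Fin n → ℝ) =>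
        lowerMulUnitary n (a.1, φ.toFun a.2))
      (LinearMap.toContinuousLinearMap (lowerMulDerivative φ t x)) (t, x) := by
  have hφ : HasFDerivAt (fun a : (Fin n × Fin n → ℝ) × (Fin n × Fin n → ℝ) =>
      (φ.toFun a.2 : Matrix (Fin n) (Fin n) ℂ)) _ (t, x) :=
    HasFDerivAt.comp (t, x) (f := Prod.snd)
      (g := fun y => (φ.toFun y : Matrix (Fin n) (Fin n) ℂ))
      (hasFDerivAt_entrywiseFDeriv (φ.differentiableAt hx)) hasFDerivAt_snd
  have hT : HasFDerivAt (fun a : (Fin n × Fin n → ℝ) × (Fin n × Fin n → ℝ) =>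
      lowerMatrix n a.1) _ (t, x) :=
    (LinearMap.toContinuousLinearMap (lowerMatrix n)).hasFDerivAt.comp (t, x) hasFDerivAt_fst
  have h := ((LinearMap.toContinuousLinearMap (matrixCoords n).toLinearMap).hasFDerivAt
    (x := lowerMatrix n t * (φ.toFun x : Matrix (Fin n) (Fin n) ℂ))).comp (t, x) (hT.mul' hφ)
  refine h.congr_fderiv (ContinuousLinearMap.ext fun v => ?_)
  change matrixCoords n (lowerMatrix n t *
      entrywiseFDeriv (fun y => (φ.toFun y : Matrix (Fin n) (Fin n) ℂ)) x v.2 +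
    lowerMatrix n v.1 * (φ.toFun x : Matrix (Fin n) (Fin n) ℂ)) = _
  rw [add_comm]
  rfl

/-- The derivative of `T ↦ T T*` in real coordinates. -/
noncomputable def choleskyDerivative (t : Fin n × Fin n → ℝ) :
    (Fin n × Fin n → ℝ) →ₗ[ℝ] (Fin n × Fin n → ℝ) where
  toFun s := lowerCoords n (lowerMatrix n s * (lowerMatrix n t).conjTranspose +
    lowerMatrix n t * (lowerMatrix n s).conjTranspose)
  map_add' a b := by
    simp only [map_add, Matrix.conjTranspose_add, add_mul, mul_add]
    abel
  map_smul' c a := by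
    simp [Matrix.conjTranspose_smul]

/-- `T ↦ T T*` in real coordinates. -/
noncomputable def choleskyMap (t : Fin n × Fin n → ℝ) : Fin n × Fin n → ℝ :=
  lowerCoords n (lowerMatrix n t * (lowerMatrix n t).conjTranspose)

lemma hasFDerivAt_choleskyMap (t : Fin n × Fin n → ℝ) :
    HasFDerivAt choleskyMap (LinearMap.toContinuousLinearMap (choleskyDerivative t)) t := by
  let L : (Fin n × Fin n → ℝ) →ₗ[ℝ] Matrix (Fin n) (Fin n) ℂ :=
    { toFun s := (lowerMatrix n s).conjTranspose
      map_add' a b := by simp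
      map_smul' c a := by simp [Matrix.conjTranspose_smul] }
  have hT : HasFDerivAt (fun s => lowerMatrix n s) _ t :=
    (LinearMap.toContinuousLinearMap (lowerMatrix n)).hasFDerivAt
  have hL : HasFDerivAt (fun s => (lowerMatrix n s).conjTranspose) _ t :=
    (LinearMap.toContinuousLinearMap L).hasFDerivAt
  have h := ((LinearMap.toContinuousLinearMap (lowerCoords n)).hasFDerivAt
    (x := lowerMatrix n t * (lowerMatrix n t).conjTranspose)).comp t (hT.mul' hL)
  refine h.congr_fderiv (ContinuousLinearMap.ext fun v => ?_)
  change lowerCoords n (lowerMatrix n t * (lowerMatrix n v).conjTranspose +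
    lowerMatrix n v * (lowerMatrix n t).conjTranspose) = _
  rw [add_comm]
  rfl

end Derivative

/-! ### The two Jacobian determinants -/

section Jacobian

variable {n : ℕ}

/-- The determinant of the block triangular map `(v, w) ↦ (v + A w, C w)`. -/
lemma LinearMap.det_shear {V W : Type*} [AddCommGroup V] [AddCommGroup W] [Module ℝ V] [Module ℝ W]
    [FiniteDimensional ℝ V] [FiniteDimensional ℝ W] (A : W →ₗ[ℝ] V) (C : W →ₗ[ℝ] W) :
    LinearMap.det ((LinearMap.fst ℝ V W + A ∘ₗ LinearMap.snd ℝ V W).prod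
      (C ∘ₗ LinearMap.snd ℝ V W)) = LinearMap.det C := by
  classical
  let b := Module.finBasis ℝ V
  let c := Module.finBasis ℝ W
  have h : LinearMap.toMatrix (b.prod c) (b.prod c)
      ((LinearMap.fst ℝ V W + A ∘ₗ LinearMap.snd ℝ V W).prod (C ∘ₗ LinearMap.snd ℝ V W)) =
      Matrix.fromBlocks 1 (LinearMap.toMatrix c b A) 0 (LinearMap.toMatrix c c C) := by
    ext (i | i) (j | j)
    · simp [LinearMap.toMatrix_apply, Matrix.one_apply, Finsupp.single_apply, eq_comm]
    all_goals simp [LinearMap.toMatrix_apply]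
  rw [← LinearMap.det_toMatrix (b.prod c), h, Matrix.det_fromBlocks_zero₂₁, Matrix.det_one, one_mul,
    LinearMap.det_toMatrix]

/-- The Jacobian of `(T, x) ↦ T φ(x)` factors: after right multiplication by `U*`, the derivative
`(dT, dG) ↦ dT + T dG` is block triangular, and its lower right block is `mulLowerSkew` applied to
the pullback of the forms `dU · U*`. -/
lemma abs_det_lowerMulDerivative (φ : UnitaryParametrization n) {t x : Fin n × Fin n → ℝ}
    (ht : t ∈ positiveDiagonal n) :
    |LinearMap.det (lowerMulDerivative φ t x)| = triangularJacobian t * |φ.pullbackCoeff x| := by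
  set U := (φ.toFun x : Matrix (Fin n) (Fin n) ℂ) with hUdef
  have hU : U.conjTranspose * U = 1 := Matrix.mem_unitaryGroup_iff'.1 (φ.toFun x).2
  let dφ : (Fin n × Fin n → ℝ) →ₗ[ℝ] Matrix (Fin n) (Fin n) ℂ :=
    (entrywiseFDeriv (fun y => (φ.toFun y : Matrix (Fin n) (Fin n) ℂ)) x).toLinearMap
  let B : (Fin n × Fin n → ℝ) →ₗ[ℝ] Matrix (Fin n) (Fin n) ℂ := mulConjTransposeRight U ∘ₗ dφ
  let A := lowerCoords n ∘ₗ LinearMap.mulLeft ℝ (lowerMatrix n t) ∘ₗ B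
  let C := mulLowerSkew t ∘ₗ skewHermitianCoords n ∘ₗ B
  have hfac : lowerMulDerivative φ t x = mulRightCoords U ∘ₗ
      ((LinearMap.fst ℝ _ _ + A ∘ₗ LinearMap.snd ℝ _ _).prod (C ∘ₗ LinearMap.snd ℝ _ _)) := by
    refine LinearMap.ext fun e => ?_
    have h1 : ((LinearMap.fst ℝ _ _ + A ∘ₗ LinearMap.snd ℝ _ _).prod
        (C ∘ₗ LinearMap.snd ℝ _ _)) e =
        matrixCoords n (lowerMatrix n e.1 + lowerMatrix n t * B e.2) := by
      rw [matrixCoords_apply, map_add, map_add, lowerCoords_lowerMatrix,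
        skewHermitianCoords_lowerMatrix, skewHermitianCoords_lowerMatrix_mul, zero_add]
      rfl
    rw [LinearMap.comp_apply, h1]
    have h2 : B e.2 * U = dφ e.2 := by
      change dφ e.2 * U.conjTranspose * U = _
      rw [mul_assoc, hU, mul_one]
    simp only [mulRightCoords, LinearMap.comp_apply, LinearEquiv.coe_coe,
      LinearEquiv.symm_apply_apply, LinearMap.mulRight_apply, add_mul, mul_assoc, h2]
    rfl
  have hco : LinearMap.det (skewHermitianCoords n ∘ₗ B) = φ.pullbackCoeff x := by
    rw [← LinearMap.det_toMatrix', ← Matrix.det_transpose]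
    change Matrix.det _ = Matrix.det _
    congr 1
    ext p q
    rw [Matrix.transpose_apply, LinearMap.toMatrix'_apply]
    change skewHermitianCoords n (mulConjTransposeRight U (entrywiseFDeriv _ x _)) q = _
    rw [entrywiseFDeriv_apply]
    rfl
  rw [hfac, LinearMap.det_comp, abs_mul, abs_det_mulRightCoords, one_mul, LinearMap.det_shear,
    LinearMap.det_comp, hco, abs_mul, det_mulLowerSkew, abs_of_pos (triangularJacobian_pos ht)]

/-- With the coordinates of the lower triangle ordered row by row, the derivative of `T ↦ T T*` is
triangular. -/
lemma det_choleskyDerivative (t : Fin n × Fin n → ℝ) :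
    LinearMap.det (choleskyDerivative t) = 2 ^ n * triangularJacobian t := by
  have hprod : 2 ^ n * triangularJacobian t = ∏ p : Fin n × Fin n,
      ((if p.1 = p.2 then 2 else 1) * t (min p.1 p.2, min p.1 p.2)) := by
    have h2 : ∏ p : Fin n × Fin n, (if p.1 = p.2 then (2 : ℝ) else 1) = 2 ^ n := by
      rw [Fintype.prod_prod_type]
      simp
    rw [Finset.prod_mul_distrib, triangularJacobian, h2]
  rw [hprod]
  refine LinearMap.det_eq_prod_of_triangular _
    (fun p => (max p.1 p.2 : Fin n).val * n + (min p.1 p.2 : Fin n).val) _ ?_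
  rintro x ⟨a, b⟩ hx
  -- `X = S T* + T S*` at the entry in row `i` and column `j ≤ i`
  have key : ∀ i j, j ≤ i → max a b = i → min a b = j →
      (lowerMatrix n x * (lowerMatrix n t).conjTranspose +
        lowerMatrix n t * (lowerMatrix n x).conjTranspose) i j =
      (if i = j then 2 else 1) * t (j, j) * lowerMatrix n x i j := by
    intro i j hji hi hj
    have hlow : ∀ k l, l < k → k.val * n + l.val < i.val * n + j.val →
        lowerMatrix n x k l = 0 := by
      intro k l hlk hlt
      rw [lowerMatrix_apply_of_lt x hlk, hx (k, l), hx (l, k)]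
      · rfl
      · simpa [hi, hj, hlk.le] using hlt
      · simpa [hi, hj, hlk.le] using hlt
    have h1 : (lowerMatrix n x * (lowerMatrix n t).conjTranspose) i j =
        t (j, j) * lowerMatrix n x i j := by
      rw [Matrix.mul_apply, Finset.sum_eq_single j]
      · rw [Matrix.conjTranspose_apply, lowerMatrix_apply_self, mul_comm]; simp
      · intro k _ hk
        rcases hk.lt_or_gt with hk | hk
        · rw [hlow i k (hk.trans_le hji) (by have : k.val < j.val := hk; omega), zero_mul]
        · rw [Matrix.conjTranspose_apply, lowerMatrix_apply_of_gt t hk, star_zero, mul_zero]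
      · simp
    have h2 : (lowerMatrix n t * (lowerMatrix n x).conjTranspose) i j =
        if i = j then t (j, j) * lowerMatrix n x i j else 0 := by
      rw [Matrix.mul_apply]
      have hz : ∀ k, ¬ (i = j ∧ k = j) →
          lowerMatrix n t i k * (lowerMatrix n x).conjTranspose k j = 0 := by
        intro k hk
        rw [Matrix.conjTranspose_apply]
        rcases lt_trichotomy j k with h | h | h
        · rw [lowerMatrix_apply_of_gt x h, star_zero, mul_zero]
        · subst h
          have hlt : j < i := lt_of_le_of_ne hji fun e => hk ⟨e.symm, rfl⟩
          have hm : (j.val + 1) * n ≤ i.val * n := Nat.mul_le_mul_right n hlt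
          have hxj : x (j, j) = 0 := by
            refine hx (j, j) ?_
            have := j.isLt
            simp only [max_self, min_self, hi, hj]
            nlinarith
          rw [lowerMatrix_apply_self, hxj]; simp
        · have hm : j.val * n ≤ i.val * n := Nat.mul_le_mul_right n hji
          rw [hlow j k h (by have : k.val < j.val := h; omega), star_zero, mul_zero]
      split_ifs with e
      · subst e
        rw [Finset.sum_eq_single i (fun k _ hk => hz k fun h => hk h.2) (by simp),
          Matrix.conjTranspose_apply, lowerMatrix_apply_self, lowerMatrix_apply_self]
        simp
      · exact Finset.sum_eq_zero fun k _ => hz k fun h => e h.1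
    rw [Matrix.add_apply, h1, h2]
    split_ifs <;> ring
  change lowerCoords n (lowerMatrix n x * (lowerMatrix n t).conjTranspose +
    lowerMatrix n t * (lowerMatrix n x).conjTranspose) (a, b) = _
  rcases lt_trichotomy a b with h | h | h
  · have hk := key b a h.le (max_eq_right h.le) (min_eq_left h.le)
    simp only [lowerCoords, LinearMap.coe_mk, AddHom.coe_mk, h.not_ge, if_false]
    rw [hk, lowerMatrix_apply_of_lt x h]
    simp [h.ne, h.ne', h.le]
  · subst h
    have hk := key a a le_rfl (max_self _) (min_self _)
    simp only [lowerCoords, LinearMap.coe_mk, AddHom.coe_mk, le_refl, if_true]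
    rw [hk, lowerMatrix_apply_self]
    simp
  · have hk := key a b h.le (max_eq_left h.le) (min_eq_right h.le)
    simp only [lowerCoords, LinearMap.coe_mk, AddHom.coe_mk, h.le, if_true]
    rw [hk, lowerMatrix_apply_of_lt x h]
    simp [h.ne', h.le]

end Jacobian

/-! ### Gaussian integrals -/

section Gaussian

variable {n : ℕ}

lemma card_filter_min_eq (i : Fin n) :
    (Finset.univ.filter fun p : Fin n × Fin n => min p.1 p.2 = i).card =
      2 * (n - 1 - i.val) + 1 := by
  have h : (Finset.univ.filter fun p : Fin n × Fin n => min p.1 p.2 = i) =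
      ({i} ×ˢ Finset.Ici i) ∪ (Finset.Ioi i ×ˢ {i}) := by
    ext ⟨a, b⟩
    simp only [Finset.mem_filter, Finset.mem_univ, true_and, Finset.mem_union, Finset.mem_product,
      Finset.mem_singleton, Finset.mem_Ici, Finset.mem_Ioi]
    constructor
    · rintro rfl
      rcases le_or_gt a b with h | h
      · left; simp [h]
      · right; simp [h.le, h]
    · rintro (⟨rfl, h⟩ | ⟨h, rfl⟩)
      · exact min_eq_left h
      · exact min_eq_right h.le
  rw [h, Finset.card_union_of_disjoint]
  · simp only [Finset.card_product, Finset.card_singleton, Fin.card_Ici, Fin.card_Ioi]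
    omega
  · refine Finset.disjoint_left.2 ?_
    rintro ⟨a, b⟩ h1 h2
    simp only [Finset.mem_product, Finset.mem_singleton, Finset.mem_Ioi] at h1 h2
    exact absurd h1.1 h2.1.ne'

lemma triangularJacobian_eq_prod_pow (t : Fin n × Fin n → ℝ) :
    triangularJacobian t = ∏ i, t (i, i) ^ (2 * (n - 1 - i.val) + 1) := by
  rw [triangularJacobian, ← Finset.prod_fiberwise Finset.univ
    (fun p : Fin n × Fin n => min p.1 p.2)]
  refine Finset.prod_congr rfl fun i _ => ?_
  rw [Finset.prod_congr rfl (g := fun _ => t (i, i)) fun p hp => by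
    rw [(Finset.mem_filter.1 hp).2], Finset.prod_const, card_filter_min_eq]

/-- The Gaussian density of `ℝ^{n²}`. -/
noncomputable def gaussianWeight (t : Fin n × Fin n → ℝ) : ℝ := Real.exp (-∑ p, t p ^ 2)

lemma gaussianWeight_pos (t : Fin n × Fin n → ℝ) : 0 < gaussianWeight t := Real.exp_pos _

lemma gaussianWeight_eq_prod (t : Fin n × Fin n → ℝ) :
    gaussianWeight t = ∏ p, Real.exp (-t p ^ 2) := by
  rw [gaussianWeight, ← Finset.sum_neg_distrib, Real.exp_sum]

lemma integral_exp_neg_sq : ∫ s : ℝ, Real.exp (-s ^ 2) = √Real.pi := by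
  simpa using integral_gaussian 1

lemma integrable_exp_neg_sq : Integrable fun s : ℝ => Real.exp (-s ^ 2) := by
  simpa using integrable_exp_neg_mul_sq one_pos

lemma integrable_gaussianWeight : Integrable (gaussianWeight (n := n)) := by
  have : gaussianWeight (n := n) = fun t => ∏ p, Real.exp (-t p ^ 2) :=
    funext gaussianWeight_eq_prod
  rw [this]
  exact Integrable.fintype_prod (f := fun _ s => Real.exp (-s ^ 2)) fun _ => integrable_exp_neg_sq

lemma integral_gaussianWeight :
    ∫ t : Fin n × Fin n → ℝ, gaussianWeight t = √Real.pi ^ (n * n) := by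
  simp_rw [gaussianWeight_eq_prod]
  rw [integral_fintype_prod_volume_eq_prod fun _ s => Real.exp (-s ^ 2), integral_exp_neg_sq]
  simp

lemma lintegral_gaussianWeight_mul :
    ∫⁻ e : (Fin n × Fin n → ℝ) × (Fin n × Fin n → ℝ),
      ENNReal.ofReal (gaussianWeight e.1 * gaussianWeight e.2) =
      ENNReal.ofReal (Real.pi ^ (n ^ 2)) := by
  rw [Measure.volume_eq_prod, ← ofReal_integral_eq_lintegral_ofReal
    (integrable_gaussianWeight.mul_prod integrable_gaussianWeight)
    (Filter.Eventually.of_forall fun e =>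
      (mul_pos (gaussianWeight_pos e.1) (gaussianWeight_pos e.2)).le)]
  congr 1
  have h := integral_prod_mul (μ := (volume : Measure (Fin n × Fin n → ℝ)))
    (ν := (volume : Measure (Fin n × Fin n → ℝ))) gaussianWeight gaussianWeight
  refine h.trans ?_
  rw [integral_gaussianWeight, ← mul_pow, Real.mul_self_sqrt Real.pi_pos.le, sq]

lemma integral_pow_mul_exp_neg_sq (k : ℕ) :
    ∫ s in Set.Ioi (0 : ℝ), s ^ (2 * k + 1) * Real.exp (-s ^ 2) = (Nat.factorial k : ℝ) / 2 := by
  have h := integral_rpow_mul_exp_neg_rpow (p := 2) (q := 2 * k + 1) two_pos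
    (by have : (0 : ℝ) ≤ k := k.cast_nonneg
        linarith)
  have h2 : ((2 * k + 1 : ℝ) + 1) / 2 = k + 1 := by ring
  rw [h2, Real.Gamma_nat_eq_factorial] at h
  rw [← one_div_mul_eq_div, ← h]
  refine setIntegral_congr_fun measurableSet_Ioi fun s _ => ?_
  rw [← Real.rpow_natCast s (2 * k + 1)]
  norm_num

/-- The one-dimensional factors of the Gaussian integral over triangular matrices. -/
noncomputable def triangularFactor (p : Fin n × Fin n) (s : ℝ) : ℝ :=
  if p.1 = p.2 then
    (Set.Ioi (0 : ℝ)).indicator (fun s => s ^ (2 * (n - 1 - p.1.val) + 1) * Real.exp (-s ^ 2)) s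
  else Real.exp (-s ^ 2)

lemma integral_triangularFactor (p : Fin n × Fin n) :
    ∫ s, triangularFactor p s =
      if p.1 = p.2 then (Nat.factorial (n - 1 - p.1.val) : ℝ) / 2 else √Real.pi := by
  unfold triangularFactor
  split_ifs
  · rw [integral_indicator measurableSet_Ioi, integral_pow_mul_exp_neg_sq]
  · exact integral_exp_neg_sq

lemma integrable_triangularFactor (p : Fin n × Fin n) : Integrable (triangularFactor p) := by
  by_contra h
  -- the integral of a non-integrable function is `0`, but this one is positive
  have h1 := integral_undef h
  have h2 := integral_triangularFactor p
  rw [h1] at h2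
  have h3 : (0 : ℝ) <
      if p.1 = p.2 then (Nat.factorial (n - 1 - p.1.val) : ℝ) / 2 else √Real.pi := by
    split_ifs
    · exact div_pos (Nat.cast_pos.2 (Nat.factorial_pos _)) two_pos
    · exact Real.sqrt_pos.2 Real.pi_pos
  exact h3.ne h2

lemma indicator_positiveDiagonal :
    (positiveDiagonal n).indicator (fun t => triangularJacobian t * gaussianWeight t) =
      fun t => ∏ p, triangularFactor p (t p) := by
  funext t
  by_cases ht : t ∈ positiveDiagonal n
  · rw [Set.indicator_of_mem ht, triangularJacobian_eq_prod_pow, gaussianWeight_eq_prod]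
    have h : ∏ i, t (i, i) ^ (2 * (n - 1 - i.val) + 1) =
        ∏ p : Fin n × Fin n, if p.1 = p.2 then t p ^ (2 * (n - 1 - p.1.val) + 1) else 1 := by
      rw [Fintype.prod_prod_type]
      simp
    rw [h, ← Finset.prod_mul_distrib]
    refine Finset.prod_congr rfl ?_
    rintro ⟨i, j⟩ -
    by_cases e : i = j
    · subst e
      have := ht i
      simp [triangularFactor, this]
    · simp [triangularFactor, e]
  · rw [Set.indicator_of_notMem ht]
    simp only [positiveDiagonal, Set.mem_ofPred_eq, not_forall] at ht
    obtain ⟨i, hi⟩ := ht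
    refine (Finset.prod_eq_zero (Finset.mem_univ (i, i)) ?_).symm
    simp [triangularFactor, hi]

/-- The Gaussian integral over lower triangular matrices with positive diagonal, with the Jacobian
of `(T, U) ↦ T U` as density. -/
noncomputable def triangularConstant (n : ℕ) : ℝ :=
  ∫ t in positiveDiagonal n, triangularJacobian t * gaussianWeight t

lemma triangularConstant_eq : triangularConstant n =
    Real.pi ^ (n * (n - 1) / 2) * (∏ k ∈ Finset.range n, (Nat.factorial k : ℝ)) / 2 ^ n := by
  rw [triangularConstant, ← integral_indicator (isOpen_positiveDiagonal n).measurableSet,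
    indicator_positiveDiagonal, integral_fintype_prod_volume_eq_prod triangularFactor]
  simp_rw [integral_triangularFactor]
  rw [Fintype.prod_prod_type]
  have h1 : ∀ i : Fin n, (∏ j : Fin n,
      if i = j then (Nat.factorial (n - 1 - i.val) : ℝ) / 2 else √Real.pi) =
      (Nat.factorial (n - 1 - i.val) : ℝ) / 2 * √Real.pi ^ (n - 1) := by
    intro i
    rw [← Finset.mul_prod_erase _ _ (Finset.mem_univ i), if_pos rfl,
      Finset.prod_congr rfl (g := fun _ => √Real.pi) fun j hj =>
        if_neg (Finset.ne_of_mem_erase hj).symm]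
    simp
  rw [Finset.prod_congr rfl fun i _ => h1 i, Finset.prod_mul_distrib, Finset.prod_div_distrib,
    Fin.prod_univ_eq_prod_range (fun i => (Nat.factorial (n - 1 - i) : ℝ)) n,
    Finset.prod_range_reflect (fun i => (Nat.factorial i : ℝ))]
  simp only [Finset.prod_const, Finset.card_univ, Fintype.card_fin]
  have h2 : (√Real.pi ^ (n - 1)) ^ n = Real.pi ^ (n * (n - 1) / 2) := by
    obtain ⟨m, hm⟩ : Even (n * (n - 1)) := Nat.even_mul_pred_self n
    rw [← pow_mul, mul_comm (n - 1), hm, ← two_mul, Nat.mul_div_cancel_left _ two_pos, pow_mul,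
      Real.sq_sqrt Real.pi_pos.le]
  rw [h2]
  ring

lemma triangularConstant_pos (n : ℕ) : 0 < triangularConstant n := by
  rw [triangularConstant_eq]
  have : ∀ k ∈ Finset.range n, (0 : ℝ) < Nat.factorial k := fun k _ =>
    Nat.cast_pos.2 (Nat.factorial_pos k)
  have := Finset.prod_pos this
  have := Real.pi_pos
  positivity

lemma lintegral_triangularJacobian_mul_gaussianWeight :
    ∫⁻ t in positiveDiagonal n, ENNReal.ofReal (triangularJacobian t * gaussianWeight t) =
      ENNReal.ofReal (triangularConstant n) := by
  rw [triangularConstant, ofReal_integral_eq_lintegral_ofReal]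
  · refine (integrable_indicator_iff (isOpen_positiveDiagonal n).measurableSet).1 ?_
    rw [indicator_positiveDiagonal]
    exact Integrable.fintype_prod_dep integrable_triangularFactor
  · refine (ae_restrict_iff' (isOpen_positiveDiagonal n).measurableSet).2 ?_
    exact Filter.Eventually.of_forall fun t ht =>
      (mul_pos (triangularJacobian_pos ht) (gaussianWeight_pos t)).le

/-- `|T|² = Tr (T T*)`, in coordinates. -/
lemma trace_lowerMatrix_mul_conjTranspose (t : Fin n × Fin n → ℝ) :
    (lowerMatrix n t * (lowerMatrix n t).conjTranspose).trace.re = ∑ p, t p ^ 2 := by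
  rw [← sum_coords_mul_coords, lowerCoords_lowerMatrix, skewHermitianCoords_lowerMatrix]
  simp [sq]

/-- Right multiplication by a unitary matrix preserves the Gaussian density. -/
lemma gaussianWeight_lowerMulUnitary (t : Fin n × Fin n → ℝ) (U : Matrix.unitaryGroup (Fin n) ℂ) :
    gaussianWeight (lowerMulUnitary n (t, U)).1 * gaussianWeight (lowerMulUnitary n (t, U)).2 =
      gaussianWeight t := by
  rw [gaussianWeight, gaussianWeight, gaussianWeight, ← Real.exp_add]
  congr 1
  have h := sum_coords_mul_coords (lowerMatrix n t * (U : Matrix (Fin n) (Fin n) ℂ))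
    (lowerMatrix n t * (U : Matrix (Fin n) (Fin n) ℂ))
  have hW : (U : Matrix (Fin n) (Fin n) ℂ) * (U : Matrix (Fin n) (Fin n) ℂ).conjTranspose = 1 :=
    Matrix.mem_unitaryGroup_iff.1 U.2
  rw [Matrix.conjTranspose_mul, mul_assoc, ← mul_assoc (U : Matrix (Fin n) (Fin n) ℂ), hW, one_mul,
    trace_lowerMatrix_mul_conjTranspose] at h
  rw [← h, neg_add]
  simp [lowerMulUnitary, matrixCoords_apply, sq]

end Gaussian

/-! ### The matrix-variate gamma function at `n` -/

section Gamma

variable {n : ℕ}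

lemma lowerCoords_hermitianOfCoords (x : Fin n × Fin n → ℝ) :
    lowerCoords n (hermitianOfCoords x) = x := by
  funext ⟨i, j⟩
  rcases lt_trichotomy i j with h | h | h
  · simp [lowerCoords, hermitianOfCoords, h, h.not_ge]
  · subst h; simp [lowerCoords, hermitianOfCoords]
  · simp [lowerCoords, hermitianOfCoords, h, h.le]

lemma hermitianOfCoords_lowerCoords {X : Matrix (Fin n) (Fin n) ℂ} (hX : X.IsHermitian) :
    hermitianOfCoords (lowerCoords n X) = X := by
  ext i j
  have hij := hX.apply i j
  rcases lt_trichotomy i j with h | h | h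
  · rw [← hij]
    simp [lowerCoords, hermitianOfCoords, h, h.le, h.not_ge, h.not_gt, Complex.ext_iff]
  · subst h
    simp [lowerCoords, hermitianOfCoords]
    exact hX.coe_re_apply_self i
  · simp [lowerCoords, hermitianOfCoords, h, h.le, h.not_ge, Complex.ext_iff]

lemma hermitianOfCoords_choleskyMap (t : Fin n × Fin n → ℝ) :
    hermitianOfCoords (choleskyMap t) = lowerMatrix n t * (lowerMatrix n t).conjTranspose :=
  hermitianOfCoords_lowerCoords (Matrix.isHermitian_mul_conjTranspose_self _)

lemma choleskyMap_injOn : Set.InjOn choleskyMap (positiveDiagonal n) := by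
  intro s hs t ht h
  refine lowerMatrix_mul_conjTranspose_injOn hs ht ?_
  change lowerMatrix n s * _ = lowerMatrix n t * _
  rw [← hermitianOfCoords_choleskyMap, ← hermitianOfCoords_choleskyMap, h]

lemma choleskyMap_image : choleskyMap '' positiveDiagonal n =
    {x : Fin n × Fin n → ℝ | (hermitianOfCoords x).PosDef} := by
  ext x
  constructor
  · rintro ⟨t, ht, rfl⟩
    change (hermitianOfCoords _).PosDef
    rw [hermitianOfCoords_choleskyMap]
    have hu : IsUnit (lowerMatrix n t) :=
      (Matrix.isUnit_iff_isUnit_det _).2 (isUnit_det_lowerMatrix ht)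
    have := (Matrix.IsUnit.posDef_star_right_conjugate_iff hu).2
      (Matrix.PosDef.one (n := Fin n) (R := ℂ))
    simpa [Matrix.star_eq_conjTranspose] using this
  · intro hx
    obtain ⟨t, ht, h⟩ := exists_lowerMatrix_mul_conjTranspose hx
    refine ⟨t, ht, ?_⟩
    rw [choleskyMap, h, lowerCoords_hermitianOfCoords]

/-- Substituting the Cholesky decomposition `X = T T*` turns the integral of `e^{-Tr X}` into the
Gaussian integral over triangular matrices. -/
lemma complexMatrixGamma_self (n : ℕ) :
    complexMatrixGamma n (n : ℂ) = ((2 ^ n * triangularConstant n : ℝ) : ℂ) := by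
  have h1 : ∀ x : Fin n × Fin n → ℝ, ((‖(hermitianOfCoords x).det‖ : ℝ) : ℂ) ^ ((n : ℂ) - n) *
      Complex.exp (-(hermitianOfCoords x).trace) =
      ((Real.exp (-(hermitianOfCoords x).trace.re) : ℝ) : ℂ) := by
    intro x
    have him : (hermitianOfCoords x).trace = ((hermitianOfCoords x).trace.re : ℂ) := by
      simp [Matrix.trace, hermitianOfCoords]
    rw [sub_self, Complex.cpow_zero, one_mul, Complex.ofReal_exp, Complex.ofReal_neg, ← him]
  unfold complexMatrixGamma
  simp_rw [h1]
  rw [integral_complex_ofReal, ← choleskyMap_image,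
    integral_image_eq_integral_abs_det_fderiv_smul volume
      (isOpen_positiveDiagonal n).measurableSet
      (fun t _ => (hasFDerivAt_choleskyMap t).hasFDerivWithinAt) choleskyMap_injOn,
    triangularConstant, ← integral_const_mul]
  congr 1
  refine setIntegral_congr_fun (isOpen_positiveDiagonal n).measurableSet fun t ht => ?_
  rw [hermitianOfCoords_choleskyMap, trace_lowerMatrix_mul_conjTranspose, smul_eq_mul,
    ContinuousLinearMap.det, LinearMap.coe_toContinuousLinearMap, det_choleskyDerivative, abs_of_pos
      (mul_pos (pow_pos two_pos n) (triangularJacobian_pos ht)), mul_assoc, gaussianWeight]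

end Gamma

/-! ### Cayley charts -/

section Cayley

variable {n : ℕ}

/-- The skew-Hermitian matrix with given `skewHermitianCoords`. -/
noncomputable def skewHermitianMatrix (n : ℕ) :
    (Fin n × Fin n → ℝ) →ₗ[ℝ] Matrix (Fin n) (Fin n) ℂ where
  toFun x := Matrix.of fun i j =>
    if i < j then ⟨x (j, i), x (i, j)⟩ else if j < i then ⟨-x (i, j), x (j, i)⟩ else ⟨0, x (i, i)⟩
  map_add' x y := by
    ext i j
    rcases lt_trichotomy i j with h | h | h <;> simp [h, h.not_gt, Complex.ext_iff, add_comm]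
  map_smul' c x := by
    ext i j
    rcases lt_trichotomy i j with h | h | h <;> simp [h, h.not_gt, Complex.ext_iff]

lemma skewHermitianMatrix_conjTranspose (x : Fin n × Fin n → ℝ) :
    (skewHermitianMatrix n x).conjTranspose = -skewHermitianMatrix n x := by
  ext i j
  rcases lt_trichotomy i j with h | h | h <;>
    simp [skewHermitianMatrix, h, h.not_gt, Complex.ext_iff]

lemma skewHermitianCoords_skewHermitianMatrix (x : Fin n × Fin n → ℝ) :
    skewHermitianCoords n (skewHermitianMatrix n x) = x := by
  funext ⟨i, j⟩
  rcases lt_trichotomy i j with h | h | h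
  · simp [skewHermitianCoords, skewHermitianMatrix, h, h.le]
  · subst h; simp [skewHermitianCoords, skewHermitianMatrix]
  · simp [skewHermitianCoords, skewHermitianMatrix, h, h.not_ge]

lemma skewHermitianMatrix_skewHermitianCoords {A : Matrix (Fin n) (Fin n) ℂ}
    (hA : A.conjTranspose = -A) : skewHermitianMatrix n (skewHermitianCoords n A) = A := by
  ext i j
  have hij : star (A j i) = -A i j := congrFun (congrFun hA i) j
  have hre := congrArg Complex.re hij
  have him := congrArg Complex.im hij
  simp only [Complex.star_def, Complex.conj_re, Complex.conj_im, Complex.neg_re,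
    Complex.neg_im] at hre him
  rcases lt_trichotomy i j with h | h | h
  · simp [skewHermitianCoords, skewHermitianMatrix, h, h.le, h.not_ge]
  · subst h
    simp [skewHermitianCoords, skewHermitianMatrix, Complex.ext_iff]
    linarith
  · simp [skewHermitianCoords, skewHermitianMatrix, h, h.le, h.not_ge, h.not_gt, Complex.ext_iff]
    constructor <;> linarith

/-- The denominator `1 + A` of the Cayley transform, which is invertible for skew-Hermitian `A`. -/
noncomputable def cayleyDenominator (x : Fin n × Fin n → ℝ) : Matrix (Fin n) (Fin n) ℂ :=
  1 + skewHermitianMatrix n x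

lemma cayleyDenominator_conjTranspose (x : Fin n × Fin n → ℝ) :
    (cayleyDenominator x).conjTranspose = 2 - cayleyDenominator x := by
  rw [cayleyDenominator, Matrix.conjTranspose_add, Matrix.conjTranspose_one,
    skewHermitianMatrix_conjTranspose, ← one_add_one_eq_two]
  abel

lemma isUnit_det_cayleyDenominator (x : Fin n × Fin n → ℝ) : IsUnit (cayleyDenominator x).det := by
  have h : (cayleyDenominator x).conjTranspose * cayleyDenominator x =
      1 + (skewHermitianMatrix n x).conjTranspose * skewHermitianMatrix n x := by
    rw [cayleyDenominator, Matrix.conjTranspose_add, Matrix.conjTranspose_one,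
      skewHermitianMatrix_conjTranspose]
    noncomm_ring
  have hpos : ((cayleyDenominator x).conjTranspose * cayleyDenominator x).PosDef := by
    rw [h]
    exact Matrix.PosDef.one.add_posSemidef (Matrix.posSemidef_conjTranspose_mul_self _)
  have := (Matrix.isUnit_iff_isUnit_det _).1 hpos.isUnit
  rw [Matrix.det_mul] at this
  exact isUnit_of_mul_isUnit_right this

/-- The Cayley transform `(1 - A) (1 + A)⁻¹`, turned by the scalar `ζ`. -/
noncomputable def cayleyTransform (ζ : ℂ) (x : Fin n × Fin n → ℝ) : Matrix (Fin n) (Fin n) ℂ :=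
  ζ • ((2 - cayleyDenominator x) * (cayleyDenominator x)⁻¹)

lemma cayleyTransform_mul (ζ : ℂ) (x : Fin n × Fin n → ℝ) :
    cayleyTransform ζ x * cayleyDenominator x = ζ • (2 - cayleyDenominator x) := by
  rw [cayleyTransform, Matrix.smul_mul, mul_assoc,
    Matrix.nonsing_inv_mul _ (isUnit_det_cayleyDenominator x), mul_one]

lemma cayleyTransform_mem {ζ : ℂ} (hζ : ζ * star ζ = 1) (x : Fin n × Fin n → ℝ) :
    cayleyTransform ζ x ∈ Matrix.unitaryGroup (Fin n) ℂ := by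
  have hP := isUnit_det_cayleyDenominator x
  rw [Matrix.mem_unitaryGroup_iff, Matrix.star_eq_conjTranspose, cayleyTransform,
    Matrix.conjTranspose_smul, Matrix.smul_mul, Matrix.mul_smul, smul_smul, hζ, one_smul,
    Matrix.conjTranspose_mul, ← cayleyDenominator_conjTranspose,
    Matrix.conjTranspose_conjTranspose, Matrix.conjTranspose_nonsing_inv]
  set P := cayleyDenominator x
  have hcomm : P * P.conjTranspose = P.conjTranspose * P := by
    rw [show P.conjTranspose = 2 - P from cayleyDenominator_conjTranspose x]
    noncomm_ring
  have hPc : IsUnit P.conjTranspose.det := by rw [Matrix.det_conjTranspose]; exact hP.star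
  calc P.conjTranspose * P⁻¹ * (P.conjTranspose⁻¹ * P)
      = P.conjTranspose * (P.conjTranspose * P)⁻¹ * P := by
        rw [Matrix.mul_inv_rev]; simp only [mul_assoc]
    _ = (P.conjTranspose * P.conjTranspose⁻¹) * (P⁻¹ * P) := by
        rw [← hcomm, Matrix.mul_inv_rev]; simp only [mul_assoc]
    _ = 1 := by rw [Matrix.mul_nonsing_inv _ hPc, Matrix.nonsing_inv_mul _ hP, one_mul]

/-- `U + ζ = 2 ζ (1 + A)⁻¹` is invertible for `U = ζ (1 - A) (1 + A)⁻¹`. -/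
lemma isUnit_cayleyTransform_add {ζ : ℂ} (hζ : ζ * star ζ = 1) (x : Fin n × Fin n → ℝ) :
    IsUnit (cayleyTransform ζ x + ζ • 1) := by
  have h : (cayleyTransform ζ x + ζ • 1) * cayleyDenominator x = (2 * ζ) • 1 := by
    rw [add_mul, cayleyTransform_mul, Matrix.smul_mul, one_mul, ← smul_add, sub_add_cancel,
      mul_comm, ← smul_smul, two_smul, one_add_one_eq_two]
  have h0 : ζ ≠ 0 := by rintro rfl; simp at hζ
  have hd : IsUnit ((cayleyTransform ζ x + ζ • 1) * cayleyDenominator x).det := by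
    rw [h, Matrix.det_smul, Matrix.det_one, mul_one]
    exact (IsUnit.mk0 _ (mul_ne_zero two_ne_zero h0)).pow _
  rw [Matrix.det_mul] at hd
  exact (Matrix.isUnit_iff_isUnit_det _).2 (isUnit_of_mul_isUnit_left hd)

lemma skewHermitianMatrix_injective : Function.Injective (skewHermitianMatrix n) :=
  Function.LeftInverse.injective skewHermitianCoords_skewHermitianMatrix

lemma cayleyTransform_injective {ζ : ℂ} (hζ : ζ * star ζ = 1) :
    Function.Injective (cayleyTransform (n := n) ζ) := by
  intro x y h
  have hx := cayleyTransform_mul ζ x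
  have hy := cayleyTransform_mul ζ y
  have h1 : (cayleyTransform ζ x + ζ • 1) * cayleyDenominator x =
      (cayleyTransform ζ x + ζ • 1) * cayleyDenominator y := by
    rw [add_mul, add_mul, hx, h, hy, smul_sub, smul_sub]
    simp
  have h2 := (isUnit_cayleyTransform_add hζ x).mul_left_cancel h1
  exact skewHermitianMatrix_injective (add_left_cancel h2)

open scoped Matrix.Norms.Operator in
lemma contDiff_cayleyTransform_apply (ζ : ℂ) (i j : Fin n) :
    ContDiff ℝ 1 fun x : Fin n × Fin n → ℝ => cayleyTransform ζ x i j := by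
  have hP : ContDiff ℝ 1 (cayleyDenominator (n := n)) :=
    contDiff_const.add (LinearMap.toContinuousLinearMap (skewHermitianMatrix n)).contDiff
  have hinv : ContDiff ℝ 1 fun x : Fin n × Fin n → ℝ => (cayleyDenominator x)⁻¹ := by
    refine contDiff_iff_contDiffAt.2 fun x => ?_
    obtain ⟨u, hu⟩ := (Matrix.isUnit_iff_isUnit_det _).2 (isUnit_det_cayleyDenominator x)
    have h := contDiffAt_ringInverse ℝ u (n := 1)
    rw [hu] at h
    simp_rw [Matrix.nonsing_inv_eq_ringInverse]
    exact h.comp x hP.contDiffAt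
  have h := ((contDiff_const (c := (2 : Matrix (Fin n) (Fin n) ℂ))).sub hP).mul hinv
  exact (contDiff_const (c := ζ)).mul
    ((LinearMap.toContinuousLinearMap (Matrix.entryLinearMap ℝ ℂ i j)).contDiff.comp h)

open scoped Matrix.Norms.Operator in
/-- Differentiating `U P = ζ (2 - P)`, with `P = 1 + A`, gives `dU P = -(U + ζ) dA`. -/
lemma entrywiseFDeriv_cayleyTransform_mul (ζ : ℂ) (x v : Fin n × Fin n → ℝ) :
    entrywiseFDeriv (cayleyTransform ζ) x v * cayleyDenominator x =
      -((cayleyTransform ζ x + ζ • 1) * skewHermitianMatrix n v) := by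
  have hU : HasFDerivAt (cayleyTransform ζ) (entrywiseFDeriv (cayleyTransform ζ) x) x :=
    hasFDerivAt_entrywiseFDeriv fun i j =>
      ((contDiff_cayleyTransform_apply ζ i j).differentiable one_ne_zero).differentiableAt
  have hP : HasFDerivAt (cayleyDenominator (n := n))
      (LinearMap.toContinuousLinearMap (skewHermitianMatrix n)) x :=
    (LinearMap.toContinuousLinearMap (skewHermitianMatrix n)).hasFDerivAt.const_add 1
  have h1 := hU.mul' hP
  have h2 : HasFDerivAt (cayleyTransform ζ * cayleyDenominator)
      (ζ • -LinearMap.toContinuousLinearMap (skewHermitianMatrix n)) x := by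
    have : cayleyTransform ζ * cayleyDenominator (n := n) =
        fun x => ζ • (2 - cayleyDenominator x) := funext fun x => cayleyTransform_mul ζ x
    rw [this]
    exact (hP.const_sub 2).const_smul ζ
  have h := congrArg (fun L : (Fin n × Fin n → ℝ) →L[ℝ] Matrix (Fin n) (Fin n) ℂ => L v)
    (h1.unique h2)
  change cayleyTransform ζ x * skewHermitianMatrix n v +
    entrywiseFDeriv (cayleyTransform ζ) x v * cayleyDenominator x =
    ζ • -skewHermitianMatrix n v at h
  rw [eq_sub_of_add_eq' h, add_mul, Matrix.smul_mul, one_mul, smul_neg]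
  abel

/-- The chart of the unitary group given by the Cayley transform turned by `ζ`. -/
noncomputable def cayleyParametrization (n : ℕ) {ζ : ℂ} (hζ : ζ * star ζ = 1) :
    UnitaryParametrization n where
  source := Set.univ
  toFun x := ⟨cayleyTransform ζ x, cayleyTransform_mem hζ x⟩
  isOpen_source := isOpen_univ
  contDiffOn i j := (contDiff_cayleyTransform_apply ζ i j).contDiffOn
  injOn x _ y _ h := cayleyTransform_injective hζ (congrArg Subtype.val h)
  immersion x _ v w h := by
    have h' : entrywiseFDeriv (cayleyTransform ζ) x v =
        entrywiseFDeriv (cayleyTransform ζ) x w := by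
      rw [entrywiseFDeriv_apply, entrywiseFDeriv_apply]
      exact h
    have hv := entrywiseFDeriv_cayleyTransform_mul ζ x v
    rw [h', entrywiseFDeriv_cayleyTransform_mul, neg_inj] at hv
    exact skewHermitianMatrix_injective
      ((isUnit_cayleyTransform_add hζ x).mul_left_cancel hv).symm

/-- The Cayley chart turned by `ζ` contains all unitary matrices without the eigenvalue `-ζ`. -/
lemma mem_image_cayleyParametrization {ζ : ℂ} (hζ : ζ * star ζ = 1)
    (U : Matrix.unitaryGroup (Fin n) ℂ)
    (hU : IsUnit ((U : Matrix (Fin n) (Fin n) ℂ) + ζ • 1).det) :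
    U ∈ (cayleyParametrization n hζ).toFun '' (cayleyParametrization n hζ).source := by
  have h0 : ζ ≠ 0 := by rintro rfl; simp at hζ
  have hs0 : star ζ ≠ 0 := star_ne_zero.2 h0
  set V : Matrix (Fin n) (Fin n) ℂ := star ζ • (U : Matrix (Fin n) (Fin n) ℂ) with hV
  have hUV : ζ • V = (U : Matrix (Fin n) (Fin n) ℂ) := by rw [hV, smul_smul, hζ, one_smul]
  have hVV : V.conjTranspose * V = 1 := by
    have hUU : (U : Matrix (Fin n) (Fin n) ℂ).conjTranspose * (U : Matrix (Fin n) (Fin n) ℂ) = 1 :=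
      Matrix.mem_unitaryGroup_iff'.1 U.2
    rw [hV, Matrix.conjTranspose_smul, star_star, Matrix.smul_mul, Matrix.mul_smul, smul_smul, hζ,
      one_smul, hUU]
  have hW : IsUnit (1 + V).det := by
    have : 1 + V = star ζ • ((U : Matrix (Fin n) (Fin n) ℂ) + ζ • 1) := by
      rw [smul_add, smul_smul, mul_comm, hζ, one_smul, add_comm]
    rw [this, Matrix.det_smul]
    exact ((IsUnit.mk0 _ hs0).pow _).mul hU
  have hWc : IsUnit (1 + V.conjTranspose).det := by
    have h : (1 + V.conjTranspose) = (1 + V).conjTranspose := by simp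
    rw [h, Matrix.det_conjTranspose]; exact hW.star
  set P : Matrix (Fin n) (Fin n) ℂ := (2 : ℂ) • (1 + V)⁻¹ with hP
  have hPc : P.conjTranspose = 2 - P := by
    have h1 : P.conjTranspose = (2 : ℂ) • (1 + V.conjTranspose)⁻¹ := by
      rw [hP, Matrix.conjTranspose_smul, Matrix.conjTranspose_nonsing_inv]
      simp
    have h2 : (1 + V.conjTranspose)⁻¹ = V * (1 + V)⁻¹ := by
      refine Matrix.inv_eq_right_inv ?_
      rw [← mul_assoc, add_mul, hVV, one_mul, add_comm V, Matrix.mul_nonsing_inv _ hW]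
    rw [eq_sub_iff_add_eq, h1, h2, hP, ← smul_add]
    have h3 : V * (1 + V)⁻¹ + (1 + V)⁻¹ = 1 := by
      calc V * (1 + V)⁻¹ + (1 + V)⁻¹ = (1 + V) * (1 + V)⁻¹ := by rw [add_mul, one_mul, add_comm]
        _ = 1 := Matrix.mul_nonsing_inv _ hW
    rw [h3, two_smul, one_add_one_eq_two]
  have hA : (P - 1).conjTranspose = -(P - 1) := by
    rw [Matrix.conjTranspose_sub, hPc, Matrix.conjTranspose_one, ← one_add_one_eq_two]
    abel
  refine ⟨skewHermitianCoords n (P - 1), trivial, Subtype.ext ?_⟩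
  change cayleyTransform ζ _ = _
  have hden : cayleyDenominator (skewHermitianCoords n (P - 1)) = P := by
    rw [cayleyDenominator, skewHermitianMatrix_skewHermitianCoords hA, add_sub_cancel]
  have hPinv : P⁻¹ = (2⁻¹ : ℂ) • (1 + V) := by
    refine Matrix.inv_eq_right_inv ?_
    rw [hP, Matrix.smul_mul, Matrix.mul_smul, smul_smul, Matrix.nonsing_inv_mul _ hW]
    simp
  have hPu : IsUnit P.det := by
    rw [← hden]; exact isUnit_det_cayleyDenominator _
  rw [cayleyTransform, hden, sub_mul, Matrix.mul_nonsing_inv _ hPu, hPinv, ← hUV,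
    ← one_add_one_eq_two, add_mul, one_mul, ← add_smul]
  norm_num

/-- Countably many Cayley charts cover the unitary group, since a matrix has only finitely many
eigenvalues. -/
lemma exists_countable_cover (n : ℕ) : ∃ φ : ℕ → UnitaryParametrization n,
    ⋃ k, (φ k).toFun '' (φ k).source = Set.univ := by
  -- infinitely many numbers of modulus one
  let ζ : ℕ → ℂ := fun k => (k + Complex.I) / (k - Complex.I)
  have hne : ∀ k : ℕ, (k : ℂ) - Complex.I ≠ 0 := fun k h => by
    simpa using congrArg Complex.im h
  have hne' : ∀ k : ℕ, (k : ℂ) + Complex.I ≠ 0 := fun k h => by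
    simpa using congrArg Complex.im h
  have hζ : ∀ k, ζ k * star (ζ k) = 1 := by
    intro k
    have h : star (ζ k) = (k - Complex.I) / (k + Complex.I) := by
      simp [ζ, sub_eq_add_neg]
    rw [h]
    have := hne k
    have := hne' k
    simp only [ζ]
    field_simp
  have hinj : Function.Injective ζ := by
    intro a b hab
    simp only [ζ] at hab
    rw [div_eq_div_iff (hne a) (hne b)] at hab
    have := congrArg Complex.im hab
    simp at this
    have h : (a : ℝ) = b := by linarith
    exact_mod_cast h
  refine ⟨fun k => cayleyParametrization n (hζ k), Set.eq_univ_of_forall fun U => ?_⟩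
  have hfin : {k | ((-(U : Matrix (Fin n) (Fin n) ℂ)).charpoly).IsRoot (ζ k)}.Finite :=
    (Polynomial.finite_setOfPred_isRoot (Matrix.charpoly_monic _).ne_zero).preimage hinj.injOn
  obtain ⟨k, hk⟩ := hfin.exists_notMem
  refine Set.mem_iUnion.2 ⟨k, mem_image_cayleyParametrization (hζ k) U ?_⟩
  refine isUnit_iff_ne_zero.2 fun h => hk ?_
  change Polynomial.eval _ _ = 0
  rw [Matrix.eval_charpoly, sub_neg_eq_add, add_comm, Matrix.scalar_apply,
    ← Matrix.smul_one_eq_diagonal]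
  exact h

end Cayley

/-! ### The unitary factor of a Gaussian matrix -/

section UnitaryFactor

variable {n : ℕ}

instance unitaryGroupPolishSpace (n : ℕ) : PolishSpace (Matrix.unitaryGroup (Fin n) ℂ) := by
  have : PolishSpace (Matrix (Fin n) (Fin n) ℂ) :=
    inferInstanceAs (PolishSpace (Fin n → Fin n → ℂ))
  exact (isClosed_unitary (R := Matrix (Fin n) (Fin n) ℂ)).polishSpace

lemma continuous_lowerMulUnitary : Continuous (lowerMulUnitary n) := by
  have h1 : Continuous (lowerMatrix n) := (lowerMatrix n).continuous_of_finiteDimensional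
  have h2 : Continuous (matrixCoords n) :=
    (matrixCoords n).toLinearMap.continuous_of_finiteDimensional
  exact h2.comp ((h1.comp continuous_fst).matrix_mul (continuous_subtype_val.comp continuous_snd))

lemma measurableEmbedding_lowerMulUnitary :
    MeasurableEmbedding fun a : positiveDiagonal n × Matrix.unitaryGroup (Fin n) ℂ =>
      lowerMulUnitary n (a.1, a.2) := by
  have : PolishSpace (positiveDiagonal n) := (isOpen_positiveDiagonal n).polishSpace
  refine Continuous.measurableEmbedding ?_ ?_
  · exact continuous_lowerMulUnitary.comp
      ((continuous_subtype_val.comp continuous_fst).prodMk continuous_snd)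
  · rintro ⟨s, U⟩ ⟨t, V⟩ h
    have := lowerMulUnitary_injOn (x₁ := (s.1, U)) (x₂ := (t.1, V)) ⟨s.2, trivial⟩ ⟨t.2, trivial⟩ h
    rw [Prod.ext_iff] at this
    exact Prod.ext (Subtype.ext this.1) this.2

instance isAddHaarMeasure_volume_matrixCoords : Measure.IsAddHaarMeasure
    (volume : Measure ((Fin n × Fin n → ℝ) × (Fin n × Fin n → ℝ))) :=
  Measure.prod.instIsAddHaarMeasure _ _

/-- The measure `e^{-|Z|²} dZ` on complex matrices, in real coordinates. -/
noncomputable def gaussianMeasure (n : ℕ) :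
    Measure ((Fin n × Fin n → ℝ) × (Fin n × Fin n → ℝ)) :=
  volume.withDensity fun e => ENNReal.ofReal (gaussianWeight e.1 * gaussianWeight e.2)

/-- The distribution of the unitary factor `U` of `Z = T U` under `e^{-|Z|²} dZ`. -/
noncomputable def unitaryFactorMeasure (n : ℕ) : Measure (Matrix.unitaryGroup (Fin n) ℂ) :=
  ((gaussianMeasure n).comap fun a : positiveDiagonal n × Matrix.unitaryGroup (Fin n) ℂ =>
    lowerMulUnitary n (a.1, a.2)).map Prod.snd

lemma unitaryFactorMeasure_apply {A : Set (Matrix.unitaryGroup (Fin n) ℂ)} (hA : MeasurableSet A) :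
    unitaryFactorMeasure n A =
      gaussianMeasure n (lowerMulUnitary n '' (positiveDiagonal n ×ˢ A)) := by
  rw [unitaryFactorMeasure, Measure.map_apply measurable_snd hA,
    measurableEmbedding_lowerMulUnitary.comap_apply]
  congr 1
  ext e
  constructor
  · rintro ⟨⟨t, U⟩, hU, rfl⟩
    exact ⟨(t.1, U), ⟨t.2, hU⟩, rfl⟩
  · rintro ⟨⟨t, U⟩, ⟨ht, hU⟩, rfl⟩
    exact ⟨(⟨t, ht⟩, U), hU, rfl⟩

/-- Singular matrices form a null set: every line in the direction of the identity matrix meets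
them in finitely many points. -/
lemma ae_det_ne_zero :
    ∀ᵐ e : (Fin n × Fin n → ℝ) × (Fin n × Fin n → ℝ), ((matrixCoords n).symm e).det ≠ 0 := by
  have hcont : Continuous fun e => ((matrixCoords n).symm e).det :=
    Continuous.matrix_det (matrixCoords n).symm.toLinearMap.continuous_of_finiteDimensional
  let L : ℝ →ₗ[ℝ] (Fin n × Fin n → ℝ) × (Fin n × Fin n → ℝ) :=
    LinearMap.toSpanSingleton ℝ _ (matrixCoords n 1)
  refine ae_mem_of_ae_add_linearMap_mem L volume volume
    (s := {e | ((matrixCoords n).symm e).det ≠ 0})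
    (hcont.measurable (measurableSet_singleton (0 : ℂ))).compl fun e => ?_
  have hfin : {s : ℝ | ((-((matrixCoords n).symm e)).charpoly).IsRoot (s : ℂ)}.Finite :=
    (Polynomial.finite_setOfPred_isRoot (Matrix.charpoly_monic _).ne_zero).preimage
      Complex.ofReal_injective.injOn
  refine measure_mono_null (fun s hs => ?_) (hfin.measure_zero volume)
  by_contra hroot
  refine hs fun h => hroot ?_
  have hL : (matrixCoords n).symm (e + L s) = (matrixCoords n).symm e + (s : ℂ) • 1 := by
    rw [map_add, LinearMap.toSpanSingleton_apply, map_smul, LinearEquiv.symm_apply_apply]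
    simp
  rw [hL] at h
  change Polynomial.eval _ _ = 0
  rw [Matrix.eval_charpoly, sub_neg_eq_add, add_comm, Matrix.scalar_apply,
    ← Matrix.smul_one_eq_diagonal]
  exact h

lemma unitaryFactorMeasure_univ :
    unitaryFactorMeasure n Set.univ = ENNReal.ofReal (Real.pi ^ (n ^ 2)) := by
  have hae : ∀ᵐ e ∂gaussianMeasure n,
      e ∈ lowerMulUnitary n '' (positiveDiagonal n ×ˢ Set.univ) :=
    (withDensity_absolutelyContinuous _ _).ae_le
      (ae_det_ne_zero.mono fun e he => mem_image_lowerMulUnitary he)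
  have huniv := measure_congr (Filter.eventuallyEq_univ.2 hae)
  rw [unitaryFactorMeasure_apply MeasurableSet.univ]
  refine huniv.trans ?_
  rw [gaussianMeasure, withDensity_apply _ MeasurableSet.univ, Measure.restrict_univ,
    lintegral_gaussianWeight_mul]

end UnitaryFactor

/-! ### Local measures of parametrizations -/

namespace UnitaryParametrization

variable {n : ℕ} (φ : UnitaryParametrization n)

lemma continuousOn_toFun : ContinuousOn φ.toFun φ.source := by
  rw [continuousOn_iff_continuous_domRestrict]
  refine Continuous.subtype_mk (continuous_matrix fun i j => ?_) _
  exact continuousOn_iff_continuous_domRestrict.1 (φ.contDiffOn i j).continuousOn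

lemma continuousOn_pullbackCoeff : ContinuousOn φ.pullbackCoeff φ.source := by
  rw [continuousOn_iff_continuous_domRestrict]
  have hU : Continuous fun x : φ.source => (φ.toFun x : Matrix (Fin n) (Fin n) ℂ) :=
    continuous_subtype_val.comp (continuousOn_iff_continuous_domRestrict.1 φ.continuousOn_toFun)
  have hd : ∀ v, Continuous fun x : φ.source => matrixDifferential φ.toFun x v := by
    refine fun v => continuous_matrix fun i j => ?_
    have h := continuousOn_iff_continuous_domRestrict.1
      ((φ.contDiffOn i j).continuousOn_fderiv_of_isOpen φ.isOpen_source le_rfl)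
    exact h.clm_apply continuous_const
  have hP : Continuous (skewHermitianCoords n) :=
    (skewHermitianCoords n).continuous_of_finiteDimensional
  refine Continuous.matrix_det (A := fun x : φ.source => Matrix.of fun a =>
    skewHermitianCoords n (matrixDifferential φ.toFun x (Pi.single a 1) *
      (φ.toFun x : Matrix (Fin n) (Fin n) ℂ).conjTranspose)) ?_
  refine continuous_matrix fun a p => ?_
  exact (continuous_apply p).comp (hP.comp ((hd _).matrix_mul hU.matrix_conjTranspose))

lemma measurableSet_source : MeasurableSet φ.source := φ.isOpen_source.measurableSet

lemma measurableSet_image_source : MeasurableSet (φ.toFun '' φ.source) :=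
  φ.measurableSet_source.image_of_continuousOn_injOn φ.continuousOn_toFun φ.injOn

lemma measurableSet_source_inter_preimage {A : Set (Matrix.unitaryGroup (Fin n) ℂ)}
    (hA : MeasurableSet A) : MeasurableSet (φ.source ∩ φ.toFun ⁻¹' A) := by
  have h := (continuousOn_iff_continuous_domRestrict.1 φ.continuousOn_toFun).measurable hA
  have := φ.measurableSet_source.subtype_image h
  convert this using 1
  ext x
  simp [and_comm]

lemma localMeasure_apply {A : Set (Matrix.unitaryGroup (Fin n) ℂ)} (hA : MeasurableSet A) :
    φ.localMeasure A =
      ∫⁻ x in φ.source ∩ φ.toFun ⁻¹' A, ENNReal.ofReal |φ.pullbackCoeff x| := by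
  have hm : AEMeasurable φ.toFun (volume.restrict φ.source) :=
    φ.continuousOn_toFun.aemeasurable φ.measurableSet_source
  rw [localMeasure, Measure.map_apply_of_aemeasurable
    (hm.mono_ac (withDensity_absolutelyContinuous _ _)) hA, withDensity_apply',
    Measure.restrict_restrict' φ.measurableSet_source, Set.inter_comm]

/-- The change of variables `Z = T φ(x)`: on the image of a parametrization, the unitary factor of a
Gaussian matrix has the density `∧ (dU · U*)`, up to the Gaussian integral over triangular
matrices. -/
lemma unitaryFactorMeasure_inter_image {A : Set (Matrix.unitaryGroup (Fin n) ℂ)}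
    (hA : MeasurableSet A) :
    unitaryFactorMeasure n (A ∩ φ.toFun '' φ.source) =
      ENNReal.ofReal (triangularConstant n) * φ.localMeasure A := by
  set W := φ.source ∩ φ.toFun ⁻¹' A with hW
  have hWm : MeasurableSet W := φ.measurableSet_source_inter_preimage hA
  let f : (Fin n × Fin n → ℝ) × (Fin n × Fin n → ℝ) →
      (Fin n × Fin n → ℝ) × (Fin n × Fin n → ℝ) := fun a => lowerMulUnitary n (a.1, φ.toFun a.2)
  have hTm := (isOpen_positiveDiagonal n).measurableSet
  have hSm : MeasurableSet (positiveDiagonal n ×ˢ W) := hTm.prod hWm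
  have himage : lowerMulUnitary n '' (positiveDiagonal n ×ˢ (A ∩ φ.toFun '' φ.source)) =
      f '' (positiveDiagonal n ×ˢ W) := by
    ext e
    constructor
    · rintro ⟨⟨t, U⟩, ⟨ht, hUA, x, hx, hxU⟩, rfl⟩
      subst hxU
      exact ⟨(t, x), ⟨ht, hx, hUA⟩, rfl⟩
    · rintro ⟨⟨t, x⟩, ⟨ht, hx, hxA⟩, rfl⟩
      exact ⟨(t, φ.toFun x), ⟨ht, hxA, x, hx, rfl⟩, rfl⟩
  have hinj : Set.InjOn f (positiveDiagonal n ×ˢ W) := by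
    rintro ⟨s, x⟩ ⟨hs, hx⟩ ⟨t, y⟩ ⟨ht, hy⟩ h
    have h1 := lowerMulUnitary_injOn (x₁ := (s, φ.toFun x)) (x₂ := (t, φ.toFun y))
      ⟨hs, trivial⟩ ⟨ht, trivial⟩ h
    rw [Prod.ext_iff] at h1
    exact Prod.ext h1.1 (φ.injOn hx.1 hy.1 h1.2)
  have hcoeff : AEMeasurable (fun x => ENNReal.ofReal |φ.pullbackCoeff x|) (volume.restrict W) :=
    ((φ.continuousOn_pullbackCoeff.mono Set.inter_subset_left).aemeasurable hWm).abs.ennreal_ofReal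
  have hT : AEMeasurable (fun t : Fin n × Fin n → ℝ =>
      ENNReal.ofReal (triangularJacobian t * gaussianWeight t))
      (volume.restrict (positiveDiagonal n)) := by
    have : Continuous fun t : Fin n × Fin n → ℝ => triangularJacobian t * gaussianWeight t := by
      unfold triangularJacobian gaussianWeight
      fun_prop
    exact this.measurable.ennreal_ofReal.aemeasurable
  rw [unitaryFactorMeasure_apply (hA.inter φ.measurableSet_image_source), himage, gaussianMeasure,
    withDensity_apply', lintegral_image_eq_lintegral_abs_det_fderiv_mul volume hSm
      (fun a ha => (hasFDerivAt_lowerMulUnitary φ a.1 ha.2.1).hasFDerivWithinAt) hinj]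
  have hcongr : ∀ a ∈ positiveDiagonal n ×ˢ W,
      ENNReal.ofReal |(LinearMap.toContinuousLinearMap (lowerMulDerivative φ a.1 a.2)).det| *
        ENNReal.ofReal (gaussianWeight (f a).1 * gaussianWeight (f a).2) =
      ENNReal.ofReal (triangularJacobian a.1 * gaussianWeight a.1) *
        ENNReal.ofReal |φ.pullbackCoeff a.2| := by
    rintro ⟨t, x⟩ ⟨ht, hx⟩
    rw [ContinuousLinearMap.det, LinearMap.coe_toContinuousLinearMap,
      abs_det_lowerMulDerivative φ ht, gaussianWeight_lowerMulUnitary,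
      ← ENNReal.ofReal_mul (mul_nonneg (triangularJacobian_pos ht).le (abs_nonneg _)),
      ← ENNReal.ofReal_mul (mul_pos (triangularJacobian_pos ht) (gaussianWeight_pos t)).le]
    congr 1
    ring
  rw [setLIntegral_congr_fun hSm hcongr, Measure.volume_eq_prod, ← Measure.prod_restrict,
    lintegral_prod_mul hT hcoeff, lintegral_triangularJacobian_mul_gaussianWeight,
    φ.localMeasure_apply hA]

lemma localMeasure_eq_restrict : φ.localMeasure =
    ((ENNReal.ofReal (triangularConstant n))⁻¹ • unitaryFactorMeasure n).restrict
      (φ.toFun '' φ.source) := by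
  have hc0 : ENNReal.ofReal (triangularConstant n) ≠ 0 :=
    (ENNReal.ofReal_pos.2 (triangularConstant_pos n)).ne'
  ext A hA
  rw [Measure.restrict_apply hA, Measure.smul_apply, unitaryFactorMeasure_inter_image φ hA,
    smul_eq_mul, ← mul_assoc, ENNReal.inv_mul_cancel hc0 ENNReal.ofReal_ne_top, one_mul]

end UnitaryParametrization

/-! ### The volume of the unitary group -/

/-- All local measures are restrictions of one measure, which is therefore their supremum, as the
images of countably many parametrizations cover the group. -/
lemma unitaryVolumeMeasure_eq (n : ℕ) : unitaryVolumeMeasure n =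
    (ENNReal.ofReal (triangularConstant n))⁻¹ • unitaryFactorMeasure n := by
  have hle : unitaryVolumeMeasure n ≤
      (ENNReal.ofReal (triangularConstant n))⁻¹ • unitaryFactorMeasure n :=
    iSup_le fun φ => by
      rw [φ.localMeasure_eq_restrict]
      exact Measure.restrict_le_self
  obtain ⟨φ, hφ⟩ := exists_countable_cover n
  refine Measure.ext_of_iUnion_eq_univ hφ fun k => le_antisymm (Measure.restrict_mono le_rfl hle) ?_
  have h : (φ k).localMeasure ≤ unitaryVolumeMeasure n := le_iSup _ (φ k)
  have h' := Measure.restrict_mono (le_refl ((φ k).toFun '' (φ k).source)) h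
  rwa [(φ k).localMeasure_eq_restrict,
    Measure.restrict_restrict (φ k).measurableSet_image_source, Set.inter_self] at h'

lemma unitaryVolume_eq (n : ℕ) :
    unitaryVolume n = ENNReal.ofReal (Real.pi ^ (n ^ 2) / triangularConstant n) := by
  rw [unitaryVolume, lintegral_one, unitaryVolumeMeasure_eq, Measure.smul_apply,
    unitaryFactorMeasure_univ, smul_eq_mul, ENNReal.ofReal_div_of_pos (triangularConstant_pos n),
    mul_comm, div_eq_mul_inv]

theorem mainTheorem1 (n : ℕ) :
    (∀ φ : UnitaryParametrization n,
      (unitaryVolumeMeasure n).restrict (φ.toFun '' φ.source) = φ.localMeasure) ∧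
    unitaryVolume n ≠ ⊤ ∧
    ((unitaryVolume n).toReal : ℂ) =
      2 ^ n * (Real.pi : ℂ) ^ (n ^ 2) / complexMatrixGamma n (n : ℂ) ∧
    (unitaryVolume n).toReal =
      2 ^ n * Real.pi ^ (n * (n + 1) / 2) / ∏ k ∈ Finset.range n, (Nat.factorial k : ℝ) := by
  have hc := triangularConstant_pos n
  have hvol : (unitaryVolume n).toReal = Real.pi ^ (n ^ 2) / triangularConstant n := by
    rw [unitaryVolume_eq, ENNReal.toReal_ofReal (div_nonneg (pow_nonneg Real.pi_pos.le _) hc.le)]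
  refine ⟨fun φ => ?_, ?_, ?_, ?_⟩
  · rw [unitaryVolumeMeasure_eq, φ.localMeasure_eq_restrict]
  · rw [unitaryVolume_eq]
    exact ENNReal.ofReal_ne_top
  · rw [hvol, complexMatrixGamma_self]
    have h : (triangularConstant n : ℂ) ≠ 0 := by exact_mod_cast hc.ne'
    push_cast
    field_simp
  · rw [hvol, triangularConstant_eq]
    have hfac : ∏ k ∈ Finset.range n, (Nat.factorial k : ℝ) ≠ 0 :=
      Finset.prod_ne_zero_iff.2 fun k _ => Nat.cast_ne_zero.2 (Nat.factorial_ne_zero k)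
    have hexp : n * (n + 1) / 2 + n * (n - 1) / 2 = n ^ 2 := by
      obtain ⟨a, ha⟩ := Nat.even_mul_succ_self n
      obtain ⟨b, hb⟩ := Nat.even_mul_pred_self n
      have hab : n * (n + 1) + n * (n - 1) = 2 * n ^ 2 := by
        rcases n with _ | m
        · rfl
        · rw [Nat.add_sub_cancel]; ring
      omega
    rw [← hexp, pow_add]
    have := pow_pos Real.pi_pos (n * (n - 1) / 2)
    field_simp
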